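/- **Setting.** Consider a system of $N$ ordinary differential equations in solved form, $y^{k}_{d_k}=\omega^k$ with $d_k\ge 1$, where $y^k_l$ is the $l$-th derivative of $y^k$ with respect to $x$ and the $\omega^k$ are smooth functions of $x$ and of all $y^{j}_{l}$, $l<d_j$, on an open set of the phase space with these coordinates. Let $\mathbf A=\partial_x+\sum_k\big(\sum_{l<d_k-1} y^k_{l+1}\partial_{y^k_l}+\omega^k\partial_{y^k_{d_k-1}}\big)$ be its operator. Let $\mathbf Z_1,\dots,\mathbf Z_r$ be smooth, linearly independent generators of Lie point symmetries, $\mathbf Z_a=\xi_a(x,y)\partial_x+\sum_k\eta_a^k(x,y)\partial_{y^k}$; that is, their prolongations $\mathbf Z_a+\sum_k\sum_{1\le l<d_k}\eta_a^{k(l)}\partial_{y^k_l}$ to the phase space, with $\eta_a^{k(0)}=\eta_a^k$ and $\eta_a^{k(l+1)}=\mathbf A(\eta_a^{k(l)})-y^k_{l+1}\mathbf A(\xi_a)$, again denoted $\mathbf Z_a$, satisfy $[\mathbf Z_a,\mathbf A]=-\mathbf A(\xi_a)\mathbf A$. Let them be a basis of a Lie algebra $\mathbf g=\mathbf g^{(0)}$,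 $[\mathbf Z_a,\mathbf Z_c]=\sum_e C^e_{ac}\mathbf Z_e$, that is $n$-level solvable: for the derived algebras $\mathbf g^{(i+1)}=[\mathbf g^{(i)},\mathbf g^{(i)}]$ we have $\mathbf g^{(0)}\supsetneq\mathbf g^{(1)}\supsetneq\dots\supsetneq\mathbf g^{(n)}=\{0\}$. Choose the basis such that every $\mathbf g^{(i)}$ is spanned by the generators it contains. For $i<j$ the "coset" $\mathbf B^{(i)}_{(j)}$ is the set of the generators that lie in $\mathbf g^{(i)}$ but not in $\mathbf g^{(j)}$. **First integration method.** A step of the method upon a set $B$ of generators takes local coordinates $(t,w,s)$ of the phase space, $s=(s^a)_{a\in B}$, with connected fibres $\{(t,w)=\mathrm{const}\}$, such that the generators have the normal form $\mathbf Z_a=\partial_{s^a}$, $a\in B$, and $t$ can be taken as the independent variable ($\mathbf A(t)\neq0$). It restricts the system to the hypersurfaces $s=\mathrm{const}$: the operator becomes $\mathbf A/\mathbf A(t)=\hat{\mathbf A}+\sum_{a\in B}u^a(t,w)\,\partial_{s^a}$, where the operator $\hat{\mathbf A}=\partial_t+\dots$ in the variables $(t,w)$ represents the reduced system, and the $s^a$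 are recovered by the quadratures $s^a=\int u^a\,dt+c^a$. Each generator (prolonged) is replaced by its reduced form, its $(t,w)$-part. The generators in $B$ *act transitively in a suitable subspace* at a point if for some set $J$ of the coordinates the $J$-components of these generators depend, near the point, only on the coordinates in $J$, and the $J$-components of these generators and of the operator of the system are linearly independent vectors at the point. **Theorem.** Apply the first integration method near a given point, starting from the last non-zero derived algebra, along the chain $$\mathbf g^{(n-1)}=\mathbf B^{(n-1)}_{(n)}\to\mathbf B^{(n-2)}_{(n-1)}\to\dots\to\mathbf B^{(0)}_{(1)},$$ at each step upon the prolonged and reduced generators of the coset. Whatever choices were made in the first $k$ steps, $0\le k\le n$: 1. The reduced generators are symmetries of the reduced system, $[\mathbf Y_a,\hat{\mathbf A}]=-\hat{\mathbf A}(\xi_a)\hat{\mathbf A}$ with $\xi_a=\mathbf Y_a(t)$; those of $\mathbf B^{(n-k)}_{(n)}$, which have been used, are zero, the number of variables has decreased by their number, and those of $\mathbf B^{(0)}_{(n-k)}$ satisfy $[\mathbf Y_a,\mathbf Y_c]=\sum_{e}C^e_{ac}\mathbf Y_e$, summed over $\mathbf B^{(0)}_{(n-k)}$ only. 2. If $k<n$,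 the reduced generators of the next coset $\mathbf B^{(n-k-1)}_{(n-k)}$ form an Abelian algebra. If they act transitively, at the point reached, in the subspace of the coordinates in some set $J$, then there are normal form coordinates $(t,w,s)$ as above near this point, in which $t$, $s$ and some of the $w$, as many functions together as $J$ has elements, are functions of the coordinates in $J$ only. In all coordinates with the normal form the system and all its generators reduce as above. Consequently, if at each stage that is reached in this way each coset acts transitively in a suitable subspace, then the method can be applied $n$ times; then all the $r$ generators have been used (all reduced generators vanish), and the number of variables has decreased by $r$. -/

import Mathlib

open scoped ContDiff Topology

noncomputable section

/-- Points of a phase space: the coordinate `none` is the independent variable, the coordinates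
`some i` are the dependent variables and the derivatives which, together with the independent
variable, determine a solution. Vector fields on (part of) it are maps from it to itself. -/
abbrev Phase (ι : Type) : Type := Option ι → ℝ

/-! ### Solvable algebras -/

/-- `L` is `n`-level solvable: its derived series descends strictly to zero in exactly `n` steps. -/
def IsLevelSolvable (L : Type*) [LieRing L] [LieAlgebra ℝ L] (n : ℕ) : Prop :=
  LieAlgebra.derivedSeries ℝ L n = ⊥ ∧ ∀ k < n, LieAlgebra.derivedSeries ℝ L k ≠ ⊥

/-- The basis `b` is adapted to the derived series: each derived algebra is spanned by the
basis elements it contains. -/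
def IsAdapted {L : Type*} [LieRing L] [LieAlgebra ℝ L] {r : ℕ}
    (b : Module.Basis (Fin r) ℝ L) : Prop :=
  ∀ k, ∀ x ∈ LieAlgebra.derivedSeries ℝ L k,
    x ∈ Submodule.span ℝ {y | ∃ a, b a = y ∧ b a ∈ LieAlgebra.derivedSeries ℝ L k}

open Classical in
/-- The "coset" `B^{(i)}_{(j)}`: the (indices of the) basis elements that lie in the `i`-th derived
algebra and not in the `j`-th one. -/
def coset {L : Type*} [LieRing L] [LieAlgebra ℝ L] {r : ℕ}
    (b : Module.Basis (Fin r) ℝ L) (i j : ℕ) : Finset (Fin r) :=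
  {a | b a ∈ LieAlgebra.derivedSeries ℝ L i ∧ b a ∉ LieAlgebra.derivedSeries ℝ L j}

/-- The structure constants: `[b a, b c] = ∑ e, structConst b a c e • b e`. -/
def structConst {L : Type*} [LieRing L] [LieAlgebra ℝ L] {r : ℕ}
    (b : Module.Basis (Fin r) ℝ L) (a c e : Fin r) : ℝ :=
  b.repr ⁅b a, b c⁆ e

/-! ### Systems of ordinary differential equations and their operators -/

/-- A system of ODEs together with `r` vector fields, both given on a phase space: `A` is the first
order operator of the system (its solutions are the integral curves of `A`), `Z` the vector
fields. -/
structure Stage (r : ℕ) where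
  /-- labels of the phase space coordinates other than the independent variable -/
  ι : Type
  [fin : Fintype ι]
  /-- the domain -/
  dom : Set (Phase ι)
  /-- the operator of the system -/
  A : Phase ι → Phase ι
  /-- the generators -/
  Z : Fin r → Phase ι → Phase ι

attribute [instance] Stage.fin

/-- `S` is a smooth system in solved form (`A = ∂ₜ + …`), the fields `Z a` are symmetries of it,
`[Z a, A] = -A(ξ a) A` with `ξ a` the component of `Z a` along the independent variable, and they
satisfy the commutation relations with structure constants `C`. -/
structure Stage.IsSymmetric {r : ℕ} (S : Stage r) (C : Fin r → Fin r → Fin r → ℝ) : Prop where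
  isOpen_dom : IsOpen S.dom
  smooth_A : ContDiffOn ℝ ∞ S.A S.dom
  smooth_Z : ∀ a, ContDiffOn ℝ ∞ (S.Z a) S.dom
  A_none : ∀ p ∈ S.dom, S.A p none = 1
  symm : ∀ a, ∀ p ∈ S.dom, VectorField.lieBracket ℝ (S.Z a) S.A p
    = -(fderiv ℝ (fun q => S.Z a q none) p (S.A p)) • S.A p
  bracket : ∀ a c, ∀ p ∈ S.dom, VectorField.lieBracket ℝ (S.Z a) (S.Z c) p
    = ∑ e, C a c e • S.Z e p

/-- A system of `N` ordinary differential equations in solved form: the `k`-th one gives the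
derivative of order `ord k ≥ 1` of the `k`-th dependent variable as a function `rhs k` of the
independent variable and of the derivatives of lower order of all the dependent variables. -/
structure ODESystem (N : ℕ) where
  ord : Fin N → ℕ
  one_le_ord : ∀ k, 1 ≤ ord k
  dom : Set (Phase (Σ k, Fin (ord k)))
  rhs : Fin N → Phase (Σ k, Fin (ord k)) → ℝ
  isOpen_dom : IsOpen dom
  smooth_rhs : ∀ k, ContDiffOn ℝ ∞ (rhs k) dom

namespace ODESystem

variable {N : ℕ} (E : ODESystem N)

/-- The labels `(k, l)` of the `l`-th derivative of the `k`-th dependent variable, `l < ord k`. -/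
abbrev Jet : Type := Σ k, Fin (E.ord k)

/-- The `l`-th derivative of the `k`-th dependent variable; from order `ord k` on, it is replaced
by the right hand side of the equation (only `l ≤ ord k` is used). -/
def jet (k : Fin N) (l : ℕ) (p : Phase E.Jet) : ℝ :=
  if h : l < E.ord k then p (some ⟨k, l, h⟩) else E.rhs k p

/-- The operator `A = ∂ₓ + ∑ y^k_{l+1} ∂_{y^k_l} + ∑ rhs^k ∂_{y^k_{ord k - 1}}`. -/
def A (p : Phase E.Jet) : Phase E.Jet
  | none => 1
  | some i => E.jet i.1 (i.2 + 1) p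

/-- The projection to the space of the independent and the dependent variables. -/
def proj (p : Phase E.Jet) : Phase (Fin N)
  | none => p none
  | some k => p (some ⟨k, 0, E.one_le_ord k⟩)

/-- The space of the independent and the dependent variables of the system. -/
def base : Set (Phase (Fin N)) := E.proj '' E.dom

/-- The coefficients `η^{k(l)}` of the prolongation of a vector field on the space of variables:
`η^{k(l+1)} = dη^{k(l)}/dx - y^k_{l+1} dξ/dx`, with `d/dx` the derivative along solutions. -/
def prolongCoeff (V : Phase (Fin N) → Phase (Fin N)) (k : Fin N) : ℕ → Phase E.Jet → ℝ
  | 0 => fun p => V (E.proj p) (some k)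
  | l + 1 => fun p => fderiv ℝ (prolongCoeff V k l) p (E.A p)
      - E.jet k (l + 1) p * fderiv ℝ (fun q => V (E.proj q) none) p (E.A p)

/-- The prolongation of a vector field on the space of variables to the phase space. -/
def prolong (V : Phase (Fin N) → Phase (Fin N)) (p : Phase E.Jet) : Phase E.Jet
  | none => V (E.proj p) none
  | some i => E.prolongCoeff V i.1 i.2 p

/-- `V` generates a Lie point symmetry of the system. -/
def IsPointSymmetry (V : Phase (Fin N) → Phase (Fin N)) : Prop :=
  ContDiffOn ℝ ∞ V E.base ∧
  ∀ p ∈ E.dom, VectorField.lieBracket ℝ (E.prolong V) E.A p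
    = -(fderiv ℝ (fun q => V (E.proj q) none) p (E.A p)) • E.A p

/-- The system with the prolonged generators. -/
def toStage {r : ℕ} (X : Fin r → Phase (Fin N) → Phase (Fin N)) : Stage r where
  ι := E.Jet
  dom := E.dom
  A := E.A
  Z a := E.prolong (X a)

end ODESystem

/-- `X` are linearly independent Lie point symmetry generators of `E`, which span a Lie algebra
with the same structure constants as the basis `b` of `L`. -/
structure IsSymmetryAlgebra {N r : ℕ} (E : ODESystem N) {L : Type*} [LieRing L] [LieAlgebra ℝ L]
    (b : Module.Basis (Fin r) ℝ L) (X : Fin r → Phase (Fin N) → Phase (Fin N)) : Prop where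
  symm : ∀ a, E.IsPointSymmetry (X a)
  linInd : ∀ v : Fin r → ℝ, (∀ q ∈ E.base, ∑ a, v a • X a q = 0) → v = 0
  bracket : ∀ a c, ∀ q ∈ E.base, VectorField.lieBracket ℝ (X a) (X c) q
    = ∑ e, structConst b a c e • X e q

/-! ### The first integration method -/

/-- The generators with index in `B` act transitively (with orbits of dimension `#B`), near `p`,
in the subspace of the variables with label in `J`: there, they are vector fields in these
variables only, and, as such, they are at `p` linearly independent (over functions) of each other
and of the operator of the system. -/
def Stage.ActsTransitively {r : ℕ} (S : Stage r) (B : Finset (Fin r)) (J : Set (Option S.ι))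
    (p : Phase S.ι) : Prop :=
  (∃ O ∈ 𝓝 p, ∀ q ∈ O, ∀ q₂ ∈ O, (∀ j ∈ J, q j = q₂ j) →
    ∀ a ∈ B, ∀ j ∈ J, S.Z a q j = S.Z a q₂ j) ∧
  LinearIndependent ℝ (fun (o : Option B) (j : J) =>
    (o.elim (S.A p) (fun a => S.Z a p)) (j : Option S.ι))

/-- Local coordinates `(t, w, s)` of the phase space in which the generators with index in `B` have
their normal form `∂_{s^a}`, with `t` (the component `none` of the first factor) the new
independent variable. The coordinates `(t, w)`, with values in `Phase κ`, are the ones of the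
hypersurfaces `s = constant`. -/
structure NormalChart {r : ℕ} (S : Stage r) (B : Finset (Fin r)) (κ : Type) [Fintype κ] where
  Φ : OpenPartialHomeomorph (Phase S.ι) (Phase κ × (B → ℝ))
  source_subset : Φ.source ⊆ S.dom
  smooth : ContDiffOn ℝ ∞ Φ Φ.source
  smooth_symm : ContDiffOn ℝ ∞ Φ.symm Φ.target
  fibre : ∀ q, IsPreconnected {s | (q, s) ∈ Φ.target}
  normal : ∀ a : B, ∀ p ∈ Φ.source, fderiv ℝ Φ p (S.Z a p) = (0, Pi.single a 1)
  transversal : ∀ p ∈ Φ.source, (fderiv ℝ Φ p (S.A p)).1 none ≠ 0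

/-- The new variables `t`, `s` and some of the `w` are functions of the old variables with label in
`J` only, and there are as many of them as elements of `J`. So they are new coordinates of the
subspace of these variables. -/
def NormalChart.IsOver {r : ℕ} {S : Stage r} {B : Finset (Fin r)} {κ : Type} [Fintype κ]
    (c : NormalChart S B κ) (J : Set (Option S.ι)) : Prop :=
  ∃ K : Set (Option κ), none ∈ K ∧ K.ncard + B.card = J.ncard ∧
    ∀ q ∈ c.Φ.source, ∀ q₂ ∈ c.Φ.source, (∀ j ∈ J, q j = q₂ j) →
      (c.Φ q).2 = (c.Φ q₂).2 ∧ ∀ k ∈ K, (c.Φ q).1 k = (c.Φ q₂).1 k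

/-- `T` is the reduction of `S` to the hypersurfaces `s = constant` of the chart `c`. In the new
coordinates, and with `t` as the parameter, the operator of the system is
`T.A + ∑ u^a(t, w) ∂_{s^a}`. So the functions `u^a = ds^a/dt` on the reduced space give the `s^a`
through the quadratures `s^a = ∫ u^a dt + const`, and what remains is the system with the operator
`T.A`. The reduced generators are the `(t, w)`-components of the old ones, which have to be
functions of `(t, w)`. -/
structure NormalChart.IsReduction {r : ℕ} {S : Stage r} {B : Finset (Fin r)} {κ : Type} [Fintype κ]
    (c : NormalChart S B κ) (domT : Set (Phase κ)) (AT : Phase κ → Phase κ)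
    (ZT : Fin r → Phase κ → Phase κ) : Prop where
  dom_eq : domT = Prod.fst '' c.Φ.target
  operator : ∃ u : Phase κ → B → ℝ, ContDiffOn ℝ ∞ u domT ∧
    ∀ p ∈ c.Φ.source, fderiv ℝ c.Φ p (S.A p)
      = ((fderiv ℝ c.Φ p (S.A p)).1 none) • (AT (c.Φ p).1, u (c.Φ p).1)
  generators : ∀ a, ∀ p ∈ c.Φ.source, (fderiv ℝ c.Φ p (S.Z a p)).1 = ZT a (c.Φ p).1

/-- `FirstIntegration b n S₀ p₀ k S p`: starting with the system `S₀` near the point `p₀`, the first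
integration method has been applied `k` times, upon the successive "cosets"
`B^{(n-1)}_{(n)}, B^{(n-2)}_{(n-1)}, …, B^{(n-k)}_{(n-k+1)}`, with the generators reduced at each
step. The result is the system `S`, and `p` corresponds to `p₀`. -/
inductive FirstIntegration {L : Type*} [LieRing L] [LieAlgebra ℝ L] {r : ℕ}
    (b : Module.Basis (Fin r) ℝ L) (n : ℕ) (S₀ : Stage r) (p₀ : Phase S₀.ι) :
    ℕ → (S : Stage r) → Phase S.ι → Prop
  | start (hp : p₀ ∈ S₀.dom) : FirstIntegration b n S₀ p₀ 0 S₀ p₀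
  | step {k : ℕ} {S : Stage r} {p : Phase S.ι} (h : FirstIntegration b n S₀ p₀ k S p) (hk : k < n)
      {κ : Type} [Fintype κ] (c : NormalChart S (coset b (n - (k + 1)) (n - k)) κ)
      (hp : p ∈ c.Φ.source) {domT : Set (Phase κ)} {AT : Phase κ → Phase κ}
      {ZT : Fin r → Phase κ → Phase κ} (hT : c.IsReduction domT AT ZT) :
      FirstIntegration b n S₀ p₀ (k + 1) ⟨κ, domT, AT, ZT⟩ (c.Φ p).1

end

/-! The derived algebras are ideals with Abelian successive quotients, and reduction by one of them
kills exactly the generators it contains. After `k` steps the generators in `g^(n-k)` are zero.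
Brackets within the next coset lie in `g^(n-k)`, so its reduced generators commute. Brackets of
these with any generator lie in the ideal `g^(n-k-1)`, so they are combinations of the coset alone.

Commuting fields are straightened by their joint flow (`exists_commuting_flow`,
`exists_straightening`): transport a slice complementary to them by the flow of `∑ s_b Z_b`, and
take the slice coordinates and `s` as new coordinates. If the `J`-components of the fields depend on
the `J`-coordinates only, the flow respects the projection to these coordinates. So do the new
coordinates, once the frame is adapted to `J` (`exists_adapted_frame`). The flow and its smoothness
come from the inverse function theorem for a Picard operator on the Banach space of curves on
`[0,1]`.

In a normal chart, bracketing with a used generator is `∂/∂s^d` (`fderiv_lieBracket_eq`). Hence the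
`(t,w)`-part of each generator does not depend on `s`. For the operator scaled to `A(t) = 1` the
bracket is a multiple of the operator, and the constant `t`-component makes the factor zero. So
everything reduces (`exists_isReduction`). Old and reduced fields are related by the projection to
`(t,w)`, which carries brackets to brackets, so symmetry and structure constants survive
(`IsReduction.isSymmetric`).

At the start, prolongations must inherit the commutation relations of the point symmetries
(`lieBracket_prolong`): the defect projects to zero and commutes with `A` up to a multiple of `A`,
and the solved form of the equations forces such a field to vanish. -/

section Superposition

/-! ### Superposition operators on spaces of continuous curves. -/

variable {I : Type*} [TopologicalSpace I] [CompactSpace I]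

/-- Pointwise application of a curve of operators to a curve, as an operator on curves. -/
noncomputable def ContinuousMap.applyCLM (I : Type*) [TopologicalSpace I] [CompactSpace I]
    (E F : Type*) [NormedAddCommGroup E] [NormedSpace ℝ E] [NormedAddCommGroup F]
    [NormedSpace ℝ F] : C(I, E →L[ℝ] F) →L[ℝ] C(I, E) →L[ℝ] C(I, F) :=
  LinearMap.mkContinuous₂
    (LinearMap.mk₂ ℝ (fun (L : C(I, E →L[ℝ] F)) (u : C(I, E)) =>
        (⟨fun t => L t (u t), by fun_prop⟩ : C(I, F)))
      (fun _ _ _ => by ext; simp) (fun _ _ _ => by ext; simp)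
      (fun _ _ _ => by ext; simp) (fun _ _ _ => by ext; simp))
    1 (fun L u => by
      rw [one_mul, ContinuousMap.norm_le _ (by positivity)]
      intro t
      exact ((L t).le_opNorm _).trans (mul_le_mul (L.norm_coe_le_norm t) (u.norm_coe_le_norm t)
        (norm_nonneg _) (norm_nonneg L)))

@[simp] lemma ContinuousMap.applyCLM_apply {E F : Type*} [NormedAddCommGroup E] [NormedSpace ℝ E]
    [NormedAddCommGroup F] [NormedSpace ℝ F] (L : C(I, E →L[ℝ] F)) (u : C(I, E)) (t : I) :
    ContinuousMap.applyCLM I E F L u t = L t (u t) := rfl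

variable {E F : Type*} [NormedAddCommGroup E] [NormedSpace ℝ E] [NormedAddCommGroup F]
  [NormedSpace ℝ F]

/-- The range of `u` is compact, so `fderiv ℝ f` is uniformly continuous along it. The mean value
inequality then bounds the remainder by `ε ‖v‖` simultaneously for all `t`. -/
lemma ContinuousMap.hasFDerivAt_comp_left {f : E → F} (hf : ContDiff ℝ 1 f) (u : C(I, E)) :
    HasFDerivAt (fun v : C(I, E) => (⟨f, hf.continuous⟩ : C(E, F)).comp v)
      (ContinuousMap.applyCLM I E F
        ((⟨fderiv ℝ f, hf.continuous_fderiv one_ne_zero⟩ : C(E, E →L[ℝ] F)).comp u)) u := by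
  rw [hasFDerivAt_iff_isLittleO_nhds_zero, Asymptotics.isLittleO_iff]
  intro ε hε
  have hK : IsCompact (Set.range u) := isCompact_range u.continuous
  have hunif := hK.uniformContinuousAt_of_continuousAt (fderiv ℝ f)
    (fun a _ => (hf.continuous_fderiv one_ne_zero).continuousAt)
    (Metric.dist_mem_uniformity hε)
  obtain ⟨δ, hδ, h⟩ := Metric.mem_uniformity_dist.1 hunif
  filter_upwards [Metric.ball_mem_nhds (0 : C(I, E)) hδ] with v hv
  rw [mem_ball_zero_iff] at hv
  rw [ContinuousMap.norm_le _ (by positivity)]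
  intro t
  have hvt : ‖v t‖ < δ := (v.norm_coe_le_norm t).trans_lt hv
  have := Convex.norm_image_sub_le_of_norm_fderiv_le' (𝕜 := ℝ) (f := f) (C := ε)
    (s := Metric.ball (u t) δ) (x := u t) (y := u t + v t) (φ := fderiv ℝ f (u t))
    (fun x _ => hf.differentiable one_ne_zero x)
    (fun x hx => by
      have := h (a := u t) (b := x) (by rw [dist_comm]; exact hx) (Set.mem_range_self t)
      rw [← dist_eq_norm, dist_comm]; exact le_of_lt this)
    (convex_ball _ _) (Metric.mem_ball_self hδ) (by simpa [Metric.mem_ball, dist_eq_norm] using hvt)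
  rw [add_sub_cancel_left] at this
  exact this.trans (by gcongr; exact v.norm_coe_le_norm t)

end Superposition

universe u in
/-- Superposition with a smooth map is a smooth operator on continuous curves. -/
lemma ContinuousMap.contDiff_comp_left {I E : Type u} [TopologicalSpace I] [CompactSpace I]
    [NormedAddCommGroup E] [NormedSpace ℝ E] {F : Type u} [NormedAddCommGroup F]
    [NormedSpace ℝ F] {f : E → F} (hf : ContDiff ℝ ∞ f) :
    ContDiff ℝ ∞ (fun v : C(I, E) => (⟨f, hf.continuous⟩ : C(E, F)).comp v) := by
  refine contDiff_infty.2 fun n => ?_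
  -- The derivative of superposition with `f` is superposition with `fderiv ℝ f` followed by the
  -- bounded linear `applyCLM`. So the order of smoothness is raised with `E →L[ℝ] F` in place of
  -- `F`; the common universe makes this induction possible.
  induction n generalizing F with
  | zero => exact contDiff_zero.2 (ContinuousMap.continuous_postcomp _)
  | succ n ih =>
    have h1 : ContDiff ℝ 1 f := hf.of_le (by exact_mod_cast le_top)
    have h' : ContDiff ℝ ∞ (fderiv ℝ f) := hf.fderiv_right (by simp)
    have h2 := (ContinuousMap.applyCLM I E F).contDiff.comp (ih h')
    exact contDiff_succ_iff_hasFDerivAt.2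
      ⟨_, h2, fun u => ContinuousMap.hasFDerivAt_comp_left h1 u⟩

/-! ### Primitives of curves on the unit interval. -/

section Integration

variable {E : Type*} [NormedAddCommGroup E] [NormedSpace ℝ E] [CompleteSpace E]

open unitInterval

/-- The integral from `0` of a curve on the unit interval. -/
noncomputable def ContinuousMap.primitive (E : Type*) [NormedAddCommGroup E] [NormedSpace ℝ E]
    [CompleteSpace E] : C(I, E) →L[ℝ] C(I, E) :=
  LinearMap.mkContinuous
    { toFun := fun u => ⟨fun t => ∫ x in (0 : ℝ)..t, u (Set.projIcc 0 1 zero_le_one x), by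
        have hc : Continuous fun x : ℝ => u (Set.projIcc 0 1 zero_le_one x) :=
          u.continuous.comp continuous_projIcc
        exact (intervalIntegral.continuous_primitive
          (fun a b => hc.intervalIntegrable a b) 0).comp continuous_subtype_val⟩
      map_add' := fun u v => by
        ext t
        exact intervalIntegral.integral_add
          ((u.continuous.comp continuous_projIcc).intervalIntegrable _ _)
          ((v.continuous.comp continuous_projIcc).intervalIntegrable _ _)
      map_smul' := fun c u => by
        ext t
        exact intervalIntegral.integral_smul _ _ } 1 (fun u => by
      rw [one_mul, ContinuousMap.norm_le _ (norm_nonneg _)]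
      intro t
      refine (intervalIntegral.norm_integral_le_of_norm_le_const (C := ‖u‖)
        (fun x _ => u.norm_coe_le_norm _)).trans ?_
      rw [sub_zero, abs_of_nonneg t.2.1]
      exact mul_le_of_le_one_right (norm_nonneg _) t.2.2)

lemma ContinuousMap.primitive_apply (u : C(I, E)) (t : I) :
    ContinuousMap.primitive E u t = ∫ x in (0 : ℝ)..t, u (Set.projIcc 0 1 zero_le_one x) := rfl

lemma ContinuousMap.norm_primitive_le (u : C(I, E)) : ‖ContinuousMap.primitive E u‖ ≤ ‖u‖ := by
  simpa using (ContinuousMap.primitive E).le_of_opNorm_le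
    (LinearMap.mkContinuous_norm_le _ zero_le_one _) u

lemma ContinuousMap.primitive_map {F : Type*} [NormedAddCommGroup F] [NormedSpace ℝ F]
    [CompleteSpace F] (R : E →L[ℝ] F) (u : C(I, E)) :
    (R : C(E, F)).comp (ContinuousMap.primitive E u)
      = ContinuousMap.primitive F ((R : C(E, F)).comp u) := by
  ext t
  exact (ContinuousLinearMap.intervalIntegral_comp_comm R
    ((u.continuous.comp continuous_projIcc).intervalIntegrable _ _)).symm

/-- The fundamental theorem of calculus: a curve which, as a function on the line, has on the unit
interval a continuous derivative and starts at zero, is the primitive of this derivative. -/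
lemma ContinuousMap.eq_primitive {u v : C(I, E)} {f : ℝ → E} (hf : ∀ t : I, f t = u t)
    (hf' : ∀ t : I, HasDerivAt f (v t) t) (h0 : f 0 = 0) :
    u = ContinuousMap.primitive E v := by
  ext t
  rw [ContinuousMap.primitive_apply, intervalIntegral.integral_eq_sub_of_hasDerivAt (f := f),
    h0, sub_zero, hf]
  · intro x hx
    rw [Set.uIcc_of_le t.2.1] at hx
    have hx' : x ∈ Set.Icc (0 : ℝ) 1 := ⟨hx.1, hx.2.trans t.2.2⟩
    rw [Set.projIcc_of_mem _ hx']
    exact hf' ⟨x, hx'⟩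
  · exact (v.continuous.comp continuous_projIcc).intervalIntegrable _ _

/-- A curve that is a constant plus a primitive extends to a function on the line with the
expected derivative. -/
lemma ContinuousMap.exists_hasDerivAt_of_eq_add_primitive {u v : C(I, E)} {x : E}
    (h : ∀ t, u t = x + ContinuousMap.primitive E v t) :
    ∃ f : ℝ → E, (∀ t : I, f t = u t) ∧ ∀ t : I, HasDerivAt f (v t) t := by
  have hc : Continuous fun x : ℝ => v (Set.projIcc 0 1 zero_le_one x) :=
    v.continuous.comp continuous_projIcc
  refine ⟨fun t => x + ∫ x in (0 : ℝ)..t, v (Set.projIcc 0 1 zero_le_one x), fun t => ?_,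
    fun t => ?_⟩
  · rw [h, ContinuousMap.primitive_apply]
  · have := (hc.integral_hasStrictDerivAt 0 (t : ℝ)).hasDerivAt.const_add x
    rwa [Set.projIcc_of_mem _ t.2] at this

end Integration

/-! ### The inverse function theorem and smooth fixed points. -/

section InverseFunction

variable {E F : Type*} [NormedAddCommGroup E] [NormedSpace ℝ E] [CompleteSpace E]
  [NormedAddCommGroup F] [NormedSpace ℝ F]

/-- The inverse function theorem for maps that are smooth near a point. -/
lemma exists_openPartialHomeomorph_contDiffOn {f : E → F} {O : Set E} (hO : IsOpen O)
    (hf : ContDiffOn ℝ ∞ f O) {a : E} (ha : a ∈ O) (f' : E ≃L[ℝ] F)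
    (hf' : HasFDerivAt f (f' : E →L[ℝ] F) a) :
    ∃ e : OpenPartialHomeomorph E F, a ∈ e.source ∧ e.source ⊆ O ∧ (∀ x, e x = f x) ∧
      ContDiffOn ℝ ∞ e.symm e.target ∧
      ∀ x ∈ e.source, ∃ L : E ≃L[ℝ] F, HasFDerivAt f (L : E →L[ℝ] F) x := by
  have hfa : ∀ x ∈ O, ContDiffAt ℝ ∞ f x := fun x hx => hf.contDiffAt (hO.mem_nhds hx)
  have hstrict : HasStrictFDerivAt f (f' : E →L[ℝ] F) a :=
    (hfa a ha).hasStrictFDerivAt' hf' (by simp)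
  have hcont : ContinuousOn (fderiv ℝ f) O := hf.continuousOn_fderiv_of_isOpen hO (by simp)
  -- Invertible operators form an open set. On `W` the derivative is invertible at every point,
  -- which makes the local inverse smooth throughout and not only at the image of `a`.
  set W : Set E := O ∩ fderiv ℝ f ⁻¹' Set.range ContinuousLinearEquiv.toContinuousLinearMap with hW
  have hWo : IsOpen W := hcont.isOpen_inter_preimage hO ContinuousLinearEquiv.isOpen
  set e := (hstrict.toOpenPartialHomeomorph f).restrOpen W hWo with he
  have hex : ∀ x, e x = f x := fun x => rfl
  have hsub : e.source ⊆ W := fun x hx => hx.2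
  have hL : ∀ x ∈ W, ∃ L : E ≃L[ℝ] F, HasFDerivAt f (L : E →L[ℝ] F) x := by
    rintro x ⟨hx, L, hL⟩
    refine ⟨L, ?_⟩
    rw [hL]
    exact ((hfa x hx).differentiableAt (by simp)).hasFDerivAt
  refine ⟨e, ⟨hstrict.mem_toOpenPartialHomeomorph_source, ha, f', hf'.fderiv.symm⟩,
    fun x hx => (hsub hx).1, hex, ?_, fun x hx => hL x (hsub hx)⟩
  intro y hy
  have hs := e.map_target hy
  obtain ⟨L, hL⟩ := hL _ (hsub hs)
  exact (e.contDiffAt_symm hy (f₀' := L) hL (hfa _ (hsub hs).1)).contDiffWithinAt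

/-- A fixed point equation `v = H (x, v)` has a smooth solution near a point where the partial
derivative of `H` along `v` vanishes. -/
lemma exists_contDiffOn_fixedPoint {P V : Type*} [NormedAddCommGroup P] [NormedSpace ℝ P]
    [CompleteSpace P] [NormedAddCommGroup V] [NormedSpace ℝ V] [CompleteSpace V]
    {H : P × V → V} (hH : ContDiff ℝ ∞ H) {x₀ : P} {v₀ : V} (h₀ : H (x₀, v₀) = v₀)
    (h' : ∀ v, fderiv ℝ H (x₀, v₀) (0, v) = 0) :
    ∃ (φ : P → V) (O : Set P), IsOpen O ∧ x₀ ∈ O ∧ ContDiffOn ℝ ∞ φ O ∧ φ x₀ = v₀ ∧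
      ∀ x ∈ O, φ x = H (x, φ x) := by
  set h : P →L[ℝ] V := (fderiv ℝ H (x₀, v₀)).comp (ContinuousLinearMap.inl ℝ P V) with hh
  -- Fixed points over `x` are the solutions of `G z = (x, 0)`. As the partial derivative of `H`
  -- along `v` vanishes, the derivative of `G` at the base point is the shear `(x, v) ↦ (x, v - h
  -- x)`.
  set G : P × V → P × V := fun z => (z.1, z.2 - H z) with hG
  have hGs : ContDiff ℝ ∞ G := contDiff_fst.prodMk (contDiff_snd.sub hH)
  let G' : (P × V) ≃L[ℝ] (P × V) := ContinuousLinearEquiv.equivOfInverse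
    ((ContinuousLinearMap.fst ℝ P V).prod
      (ContinuousLinearMap.snd ℝ P V - h.comp (ContinuousLinearMap.fst ℝ P V)))
    ((ContinuousLinearMap.fst ℝ P V).prod
      (ContinuousLinearMap.snd ℝ P V + h.comp (ContinuousLinearMap.fst ℝ P V)))
    (fun z => by simp) (fun z => by simp)
  have hG' : HasFDerivAt G (G' : P × V →L[ℝ] P × V) (x₀, v₀) := by
    have h1 : HasFDerivAt H (h.comp (ContinuousLinearMap.fst ℝ P V)) (x₀, v₀) := by
      have h2 : h.comp (ContinuousLinearMap.fst ℝ P V) = fderiv ℝ H (x₀, v₀) := by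
        ext z
        · simp [hh]
        · simp [h']
      rw [h2]
      exact (hH.differentiable (by simp) (x₀, v₀)).hasFDerivAt
    exact hasFDerivAt_fst.prodMk (hasFDerivAt_snd.sub h1)
  obtain ⟨e, hae, -, heG, hes, -⟩ := exists_openPartialHomeomorph_contDiffOn isOpen_univ
    hGs.contDiffOn (Set.mem_univ _) G' hG'
  have hin : Continuous fun x : P => (x, (0 : V)) := by fun_prop
  have hG0 : e (x₀, v₀) = (x₀, 0) := by rw [heG, hG]; simp [h₀]
  refine ⟨fun x => (e.symm (x, 0)).2, (fun x : P => (x, (0 : V))) ⁻¹' e.target,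
    e.open_target.preimage hin, ?_, ?_, ?_, ?_⟩
  · simpa [← hG0] using e.map_source hae
  · exact contDiff_snd.comp_contDiffOn (hes.comp (by fun_prop) (fun x hx => hx))
  · simp only
    rw [← hG0, e.left_inv hae]
  · intro x hx
    have h2 : G (e.symm (x, 0)) = (x, 0) := by rw [← heG]; exact e.right_inv hx
    have h3 : (e.symm (x, 0)).1 = x := congrArg Prod.fst h2
    have h4 : (e.symm (x, 0)).2 - H (e.symm (x, 0)) = 0 := congrArg Prod.snd h2
    have h5 : (x, (e.symm (x, 0)).2) = e.symm (x, 0) := Prod.ext h3.symm rfl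
    rw [sub_eq_zero] at h4
    simp only
    rw [h5]; exact h4

end InverseFunction

/-! ### Smooth dependence of integral curves on parameters. -/

section Flow

open unitInterval

variable {E : Type} [NormedAddCommGroup E]

lemma ContinuousMap.eventually_forall_mem {X : Type*} [TopologicalSpace X] [CompactSpace X]
    {p : E} {W : Set E} (hW : W ∈ 𝓝 p) :
    ∀ᶠ u in 𝓝 (ContinuousMap.const X p), ∀ t, u t ∈ W := by
  obtain ⟨ε, hε, hsub⟩ := Metric.mem_nhds_iff.1 hW
  filter_upwards [Metric.ball_mem_nhds _ hε] with u hu t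
  exact hsub ((ContinuousMap.dist_apply_le_dist t).trans_lt hu)

variable [NormedSpace ℝ E]

/-- A map that is smooth near a point agrees near this point with a smooth map. -/
lemma ContDiffOn.exists_contDiff_eventuallyEq [FiniteDimensional ℝ E] {F : Type*}
    [NormedAddCommGroup F] [NormedSpace ℝ F] {f : E → F} {U : Set E} (hU : IsOpen U)
    (hf : ContDiffOn ℝ ∞ f U) {p : E} (hp : p ∈ U) :
    ∃ g : E → F, ContDiff ℝ ∞ g ∧ g =ᶠ[𝓝 p] f := by
  obtain ⟨ε, hε, hsub⟩ := Metric.isOpen_iff.1 hU p hp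
  let χ : ContDiffBump p := ⟨ε / 4, ε / 2, by positivity, by linarith⟩
  refine ⟨fun x => χ x • f x, contDiff_iff_contDiffAt.2 fun x => ?_, ?_⟩
  · by_cases hx : x ∈ Metric.ball p ε
    · exact χ.contDiffAt.smul (hf.contDiffAt (hU.mem_nhds (hsub hx)))
    · have hx' : x ∉ tsupport χ := by
        rw [χ.tsupport_eq]
        intro h
        exact hx (Metric.closedBall_subset_ball (by simp only [χ]; linarith) h)
      have h0 : (fun x => χ x • f x) =ᶠ[𝓝 x] fun _ => 0 := by
        filter_upwards [(notMem_tsupport_iff_eventuallyEq.1 hx')] with y hy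
        rw [hy]; simp
      exact contDiffAt_const.congr_of_eventuallyEq h0
  · filter_upwards [χ.eventuallyEq_one] with y hy
    rw [hy]; simp

variable [CompleteSpace E]

/-- Integration over the unit interval does not increase the sup norm, so `‖d‖ ≤ κ ‖d‖` with `κ <
1`. This plays the role of Grönwall's inequality, at the price of small parameters `s`. -/
lemma ContinuousMap.eq_zero_of_eq_primitive {d w : C(I, E)} (h : d = ContinuousMap.primitive E w)
    {κ : ℝ} (hκ : κ < 1) (hw : ‖w‖ ≤ κ * ‖d‖) : d = 0 := by
  have h1 : ‖d‖ ≤ κ * ‖d‖ := by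
    calc ‖d‖ = ‖ContinuousMap.primitive E w‖ := by rw [← h]
      _ ≤ _ := (ContinuousMap.norm_primitive_le w).trans hw
  have h2 : ‖d‖ ≤ 0 := by nlinarith [norm_nonneg d]
  exact norm_le_zero_iff.1 h2

variable {β : Type} [Fintype β]

/-- The integral curves of the fields `∑ b, s b • Z b` on the unit interval depend smoothly on `s`
and on the initial point. -/
lemma exists_contDiffOn_integralCurve {Z : β → E → E} (hZ : ∀ b, ContDiff ℝ ∞ (Z b)) (p : E) :
    ∃ (φ : (β → ℝ) × E → C(I, E)) (O : Set ((β → ℝ) × E)), IsOpen O ∧ (0, p) ∈ O ∧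
      ContDiffOn ℝ ∞ φ O ∧ φ (0, p) = ContinuousMap.const I p ∧
      ∀ z ∈ O, φ z = ContinuousLinearMap.const ℝ I z.2 + ContinuousMap.primitive E
        (∑ b, z.1 b • (⟨Z b, (hZ b).continuous⟩ : C(E, E)).comp (φ z)) := by
  -- The Picard operator. At `s = 0` it does not depend on the curve, so its partial derivative
  -- along the curve vanishes there. Small `s` over unit time replaces unit fields over a short
  -- time.
  let H : ((β → ℝ) × E) × C(I, E) → C(I, E) := fun z =>
    ContinuousLinearMap.const ℝ I z.1.2 + ContinuousMap.primitive E
        (∑ b, z.1.1 b • (⟨Z b, (hZ b).continuous⟩ : C(E, E)).comp z.2)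
  have hH : ContDiff ℝ ∞ H := by
    refine ((ContinuousLinearMap.const ℝ (M := E) I).contDiff.comp
      (contDiff_snd.comp contDiff_fst)).add ((ContinuousMap.primitive E).contDiff.comp
        (ContDiff.sum fun b _ => ContDiff.fun_smul ?_ ?_))
    · exact (contDiff_apply ℝ ℝ b).comp (contDiff_fst.comp contDiff_fst)
    · exact (ContinuousMap.contDiff_comp_left (hZ b)).comp contDiff_snd
  have h0 : ∀ u, H ((0, p), u) = ContinuousMap.const I p := by
    intro u
    ext t
    simp [H]
  refine exists_contDiffOn_fixedPoint hH (x₀ := (0, p)) (v₀ := ContinuousMap.const I p) (h0 _) ?_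
  intro v
  have h1 : HasFDerivAt (fun u => H ((0, p), u))
      ((fderiv ℝ H ((0, p), ContinuousMap.const I p)).comp
        (ContinuousLinearMap.inr ℝ ((β → ℝ) × E) C(I, E))) (ContinuousMap.const I p) :=
    (hH.differentiable (by simp) _).hasFDerivAt.comp (ContinuousMap.const I p)
      (hasFDerivAt_prodMk_right ((0, p) : (β → ℝ) × E) (ContinuousMap.const I p))
  have h2 : HasFDerivAt (fun u => H ((0, p), u)) (0 : C(I, E) →L[ℝ] C(I, E))
      (ContinuousMap.const I p) := by
    simp only [h0]; exact hasFDerivAt_const _ _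
  exact congrArg (fun L => L v) (h1.unique h2)

/-- The integral curves of `∑ c, s c • Z c`, for commuting fields `Z c`, vary with `s b` by a
multiple of `Z b`. -/
lemma fderiv_integralCurve {Z : β → E → E} (hZ : ∀ b, ContDiff ℝ ∞ (Z b))
    {φ : (β → ℝ) × E → C(I, E)} {O : Set ((β → ℝ) × E)} (hO : IsOpen O)
    (hφ : ContDiffOn ℝ ∞ φ O)
    (hint : ∀ z ∈ O, φ z = ContinuousLinearMap.const ℝ I z.2 + ContinuousMap.primitive E
        (∑ b, z.1 b • (⟨Z b, (hZ b).continuous⟩ : C(E, E)).comp (φ z)))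
    {z : (β → ℝ) × E} (hz : z ∈ O) [DecidableEq β] (b : β)
    (hcomm : ∀ c t, fderiv ℝ (Z b) (φ z t) (Z c (φ z t)) = fderiv ℝ (Z c) (φ z t) (Z b (φ z t)))
    {M : ℝ} (hM : ∀ c t, ‖fderiv ℝ (Z c) (φ z t)‖ ≤ M) (hs : (∑ c, |z.1 c|) * M < 1) (t : I) :
    fderiv ℝ φ z (Pi.single b 1, 0) t = (t : ℝ) • Z b (φ z t) := by
  classical
  set u := φ z with hu
  let N : β → C(I, E) → C(I, E) := fun c => (⟨Z c, (hZ c).continuous⟩ : C(E, E)).comp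
  let D : β → C(I, E) →L[ℝ] C(I, E) := fun c => ContinuousMap.applyCLM I E E
    ((⟨fderiv ℝ (Z c), (hZ c).continuous_fderiv (by simp)⟩ : C(E, E →L[ℝ] E)).comp u)
  have hφ' : HasFDerivAt φ (fderiv ℝ φ z) z :=
    ((hφ.contDiffAt (hO.mem_nhds hz)).differentiableAt (by simp)).hasFDerivAt
  have hN : ∀ c, HasFDerivAt (fun z => N c (φ z)) ((D c).comp (fderiv ℝ φ z)) z := fun c =>
    (ContinuousMap.hasFDerivAt_comp_left ((hZ c).of_le (by exact_mod_cast le_top)) u).comp z hφ'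
  have hc : ∀ c, HasFDerivAt (fun z : (β → ℝ) × E => z.1 c)
      ((ContinuousLinearMap.proj c).comp (ContinuousLinearMap.fst ℝ (β → ℝ) E)) z := fun c =>
    ((ContinuousLinearMap.proj (R := ℝ) (φ := fun _ : β => ℝ) c).comp
      (ContinuousLinearMap.fst ℝ (β → ℝ) E)).hasFDerivAt
  have hsnd : HasFDerivAt (fun z : (β → ℝ) × E => ContinuousLinearMap.const ℝ I z.2)
      ((ContinuousLinearMap.const ℝ I).comp (ContinuousLinearMap.snd ℝ (β → ℝ) E)) z :=
    ((ContinuousLinearMap.const ℝ I).comp (ContinuousLinearMap.snd ℝ (β → ℝ) E)).hasFDerivAt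
  have hR := hsnd.add ((ContinuousMap.primitive E).hasFDerivAt.comp z
    (HasFDerivAt.fun_sum fun c (_ : c ∈ Finset.univ) => (hc c).smul (hN c)))
  have heq := hφ'.unique (hR.congr_of_eventuallyEq
    (Filter.eventually_of_mem (hO.mem_nhds hz) hint))
  set v := fderiv ℝ φ z (Pi.single b 1, 0) with hv
  -- The variational equation: the integral equation differentiated along `s b`.
  have hv1 : v = ContinuousMap.primitive E (N b u + ∑ c, z.1 c • D c v) := by
    have := congrArg (fun L => L ((Pi.single b 1, 0) : (β → ℝ) × E)) heq
    simp only [add_apply, ContinuousLinearMap.comp_apply,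
      ContinuousLinearMap.coe_snd', sum_apply,
      smul_apply, ContinuousLinearMap.smulRight_apply,
      ContinuousLinearMap.coe_fst', ContinuousLinearMap.proj_apply, map_zero, zero_add,
      Finset.sum_add_distrib, ← hv] at this
    refine this.trans ?_
    rw [add_comm]
    congr 2
    rw [Finset.sum_eq_single b (fun c _ hcb => by simp [hcb]) (by simp)]
    simp [hu]
  let w : C(I, E) := ⟨fun t => (t : ℝ) • Z b (u t), by
    have := (hZ b).continuous
    fun_prop⟩
  -- The candidate `t • Z b (u t)` solves the same linear equation: its derivative is `Z b + t DZ_b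
  -- (∑ s_c Z_c)`, and commutativity turns `DZ_b Z_c` into `DZ_c Z_b`. Contraction then gives `v =
  -- w`.
  have hw1 : w = ContinuousMap.primitive E (N b u + ∑ c, z.1 c • D c w) := by
    obtain ⟨f, hf, hf'⟩ := ContinuousMap.exists_hasDerivAt_of_eq_add_primitive (u := u) (x := z.2)
      (v := ∑ c, z.1 c • N c u) (fun t => congrArg (fun u => u t) (hint z hz))
    refine ContinuousMap.eq_primitive (f := fun τ => τ • Z b (f τ)) (fun t => ?_) (fun t => ?_)
      (by simp)
    · simp [hf, w]
    · have h1 : HasDerivAt (fun τ => Z b (f τ)) (fderiv ℝ (Z b) (f t) ((∑ c, z.1 c • N c u) t)) t :=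
        ((hZ b).differentiable (by simp) (f t)).hasFDerivAt.comp_hasDerivAt _ (hf' t)
      refine ((hasDerivAt_id (t : ℝ)).smul h1).congr_deriv ?_
      simp only [hf, ContinuousMap.add_apply, ContinuousMap.sum_apply, ContinuousMap.smul_apply,
        map_sum, map_smul, Finset.smul_sum, one_smul, id]
      rw [add_comm]
      congr 1
      refine Finset.sum_congr rfl fun c _ => ?_
      have : D c w t = (t : ℝ) • fderiv ℝ (Z c) (u t) (Z b (u t)) := by simp [D, w]
      rw [this, ← hcomm]
      exact smul_comm _ _ _
  have hd : v - w = 0 := by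
    refine ContinuousMap.eq_zero_of_eq_primitive (w := ∑ c, z.1 c • D c (v - w)) ?_ hs ?_
    · conv_lhs => rw [hv1, hw1]
      rw [← map_sub]
      congr 1
      simp only [map_sub, smul_sub, Finset.sum_sub_distrib]
      abel
    · rw [Finset.sum_mul, Finset.sum_mul]
      refine (norm_sum_le _ _).trans (Finset.sum_le_sum fun c _ => ?_)
      rw [norm_smul, Real.norm_eq_abs, mul_assoc]
      gcongr
      have hM0 : 0 ≤ M := (norm_nonneg _).trans (hM c t)
      rw [ContinuousMap.norm_le _ (by positivity)]
      intro τ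
      exact ((fderiv ℝ (Z c) (u τ)).le_opNorm _).trans (mul_le_mul (hM c τ)
        ((v - w).norm_coe_le_norm τ) (norm_nonneg _) hM0)
  rw [sub_eq_zero] at hd
  rw [hd]
  rfl

end Flow

/-! ### The local action generated by commuting fields. -/

section CommutingFlow

open unitInterval

variable {E : Type} [NormedAddCommGroup E] [NormedSpace ℝ E] [CompleteSpace E]
  {β : Type} [Fintype β]

/-- The contraction estimate applied to `R ∘ (u - u')`. The hypothesis bounds the `R`-part of the
difference of velocities by the `R`-part of the difference of positions alone, so the estimate
closes although `u` and `u'` may differ. -/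
lemma ContinuousMap.map_eq_of_integralCurve {N : β → C(I, E) → C(I, E)} {s : β → ℝ} {u u' : C(I, E)}
    {x x' : E}
    (hu : u = ContinuousLinearMap.const ℝ I x + ContinuousMap.primitive E (∑ b, s b • N b u))
    (hu' : u' = ContinuousLinearMap.const ℝ I x' + ContinuousMap.primitive E (∑ b, s b • N b u'))
    (R : E →L[ℝ] E) (hx : R x = R x') {M : ℝ} (hM0 : 0 ≤ M) (hs : (∑ c, |s c|) * M < 1)
    (hM : ∀ b t, ‖R (N b u t - N b u' t)‖ ≤ M * ‖R (u t - u' t)‖) (t : I) : R (u t) = R (u' t) := by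
  have h0 : (R : C(E, E)).comp (u - u') = 0 := by
    refine ContinuousMap.eq_zero_of_eq_primitive
      (w := (R : C(E, E)).comp (∑ b, s b • (N b u - N b u'))) ?_ hs ?_
    · have h1 : u - u' = ContinuousLinearMap.const ℝ I (x - x')
          + ContinuousMap.primitive E (∑ b, s b • (N b u - N b u')) := by
        conv_lhs => rw [hu, hu']
        simp only [smul_sub, Finset.sum_sub_distrib, map_sub]
        abel
      rw [← ContinuousMap.primitive_map]
      conv_lhs => rw [h1]
      ext t
      simp [hx]
    · rw [ContinuousMap.norm_le _ (by positivity)]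
      intro t
      simp only [ContinuousMap.comp_apply, ContinuousMap.sum_apply, ContinuousMap.smul_apply,
        ContinuousMap.sub_apply]
      have h2 : (R : C(E, E)) (∑ b, s b • (N b u t - N b u' t))
          = ∑ b, s b • R (N b u t - N b u' t) := by
        simp [map_sum]
      rw [h2, Finset.sum_mul, Finset.sum_mul]
      refine (norm_sum_le _ _).trans (Finset.sum_le_sum fun c _ => ?_)
      rw [norm_smul, Real.norm_eq_abs, mul_assoc]
      gcongr
      refine (hM c t).trans ?_
      gcongr
      exact ((R : C(E, E)).comp (u - u')).norm_coe_le_norm t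
  have := congrArg (fun w => w t) h0
  simpa [sub_eq_zero] using this

/-- Commuting fields generate a local action of a vector space. If `R` is a projection and `R ∘ Z b`
factors through `R`, then the action preserves the fibres of `R`. -/
theorem exists_commuting_flow [FiniteDimensional ℝ E] [DecidableEq β] {Z : β → E → E} {U : Set E}
    (hU : IsOpen U) (hZ : ∀ b, ContDiffOn ℝ ∞ (Z b) U) {p : E} (hp : p ∈ U)
    (hcomm : ∀ b c, ∀ q ∈ U, VectorField.lieBracket ℝ (Z b) (Z c) q = 0)
    (R : E →L[ℝ] E) (hRR : ∀ x, R (R x) = R x)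
    (hR : ∀ b, ∀ q ∈ U, ∀ q₂ ∈ U, R q = R q₂ → R (Z b q) = R (Z b q₂)) :
    ∃ (Ψ : (β → ℝ) × E → E) (O : Set ((β → ℝ) × E)), IsOpen O ∧ (0, p) ∈ O ∧
      ContDiffOn ℝ ∞ Ψ O ∧ (∀ x, (0, x) ∈ O → Ψ (0, x) = x) ∧
      (∀ z ∈ O, Ψ z ∈ U ∧ ∀ b, fderiv ℝ Ψ z (Pi.single b 1, 0) = Z b (Ψ z)) ∧
      ∀ z ∈ O, ∀ z' ∈ O, z.1 = z'.1 → R z.2 = R z'.2 → R (Ψ z) = R (Ψ z') := by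
  -- Superposition needs fields smooth on all of `E`. The curves are later confined to a ball around
  -- `p` in which `g b` agrees with `Z b`.
  choose g hg hgZ using fun b => (hZ b).exists_contDiff_eventuallyEq hU hp
  obtain ⟨φ, O₀, hO₀, hpO₀, hφ, hφ0, hint⟩ := exists_contDiffOn_integralCurve hg p
  -- The summand `1` makes the bound strict at `p`, so it persists nearby.
  set M : ℝ := 1 + ∑ b, ‖fderiv ℝ (g b) p‖ with hMdef
  have hM0 : 0 ≤ M := by positivity
  have hW : ∀ᶠ q in 𝓝 p, q ∈ U ∧ ∀ b, g b =ᶠ[𝓝 q] Z b ∧ ‖fderiv ℝ (g b) q‖ ≤ M := by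
    refine Filter.Eventually.and (hU.mem_nhds hp) (Filter.eventually_all.2 fun b =>
      (hgZ b).eventually_nhds.and ?_)
    have hc : ContinuousAt (fun q => ‖fderiv ℝ (g b) q‖) p :=
      ((hg b).continuous_fderiv (by simp)).norm.continuousAt
    refine (hc.eventually_lt continuousAt_const ?_).mono fun q hq => le_of_lt hq
    have := Finset.single_le_sum (f := fun b => ‖fderiv ℝ (g b) p‖) (fun i _ => norm_nonneg _)
      (Finset.mem_univ b)
    rw [hMdef]; linarith
  obtain ⟨ρ, hρ, hball⟩ := Metric.mem_nhds_iff.1 hW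
  -- The point with the `R`-part of `y.2` and the complementary part of `y.1` has to stay in the
  -- ball as well.
  have hmix : ∀ᶠ y : E × E in 𝓝 (p, p), R y.2 + (y.1 - R y.1) ∈ Metric.ball p ρ := by
    have hc : ContinuousAt (fun y : E × E => R y.2 + (y.1 - R y.1)) (p, p) := by fun_prop
    exact hc.eventually_mem (by simpa using Metric.ball_mem_nhds p hρ)
  obtain ⟨V₁, hV₁, V₂, hV₂, hV⟩ := mem_nhds_prod_iff.1 hmix
  have hVm : (V₁ ∩ V₂) ∩ Metric.ball p ρ ∈ 𝓝 p :=
    Filter.inter_mem (Filter.inter_mem hV₁ hV₂) (Metric.ball_mem_nhds p hρ)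
  have hev : ∀ᶠ z : (β → ℝ) × E in 𝓝 (0, p), z ∈ O₀ ∧
      (∀ t, φ z t ∈ (V₁ ∩ V₂) ∩ Metric.ball p ρ) ∧ (∑ c, |z.1 c|) * (M * (1 + ‖R‖)) < 1 := by
    refine Filter.Eventually.and (hO₀.mem_nhds hpO₀) (Filter.Eventually.and ?_ ?_)
    · have hc : ContinuousAt φ (0, p) := hφ.continuousOn.continuousAt (hO₀.mem_nhds hpO₀)
      have h1 := ContinuousMap.eventually_forall_mem (X := I) hVm
      rw [← hφ0] at h1
      exact hc.eventually h1
    · have hc : ContinuousAt (fun z : (β → ℝ) × E => (∑ c, |z.1 c|) * (M * (1 + ‖R‖))) (0, p) := by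
        fun_prop
      exact hc.eventually_lt continuousAt_const (by simp)
  have hMR : M ≤ M * (1 + ‖R‖) := le_mul_of_one_le_right hM0 (by linarith [norm_nonneg R])
  obtain ⟨O, hOsub, hO, hpO⟩ := mem_nhds_iff.1 hev
  have hΨfd : ∀ z ∈ O, ∀ w, fderiv ℝ (fun z => φ z 1) z w = fderiv ℝ φ z w 1 := by
    intro z hz w
    have hφ' : HasFDerivAt φ (fderiv ℝ φ z) z :=
      ((hφ.contDiffAt (hO₀.mem_nhds (hOsub hz).1)).differentiableAt (by simp)).hasFDerivAt
    have := ((ContinuousMap.evalCLM ℝ (1 : I) : C(I, E) →L[ℝ] E).hasFDerivAt.comp z hφ').fderiv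
    exact congrArg (fun L => L w) this
  refine ⟨fun z => φ z 1, O, hO, hpO, ?_, ?_, ?_, ?_⟩
  · exact (ContinuousMap.evalCLM ℝ (1 : I) : C(I, E) →L[ℝ] E).contDiff.comp_contDiffOn
      (hφ.mono fun z hz => (hOsub hz).1)
  · intro x hx
    simp only
    rw [hint _ (hOsub hx).1]
    simp
  · intro z hz
    obtain ⟨hzO, hzV, hzs⟩ := hOsub hz
    have hzW : ∀ t, φ z t ∈ U ∧ ∀ b, g b =ᶠ[𝓝 (φ z t)] Z b ∧ ‖fderiv ℝ (g b) (φ z t)‖ ≤ M :=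
      fun t => hball (hzV t).2
    refine ⟨(hzW 1).1, fun b => ?_⟩
    have h1 := fderiv_integralCurve hg hO₀ hφ hint hzO b (fun c t => ?_)
      (fun c t => ((hzW t).2 c).2.trans hMR) hzs 1
    · rw [hΨfd z hz, h1, ((hzW 1).2 b).1.eq_of_nhds]
      simp
    · have hb := ((hzW t).2 b).1
      have hc := ((hzW t).2 c).1
      have h2 := hcomm b c _ (hzW t).1
      rw [VectorField.lieBracket, sub_eq_zero] at h2
      rw [hb.fderiv_eq, hc.fderiv_eq, hb.eq_of_nhds, hc.eq_of_nhds, h2]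
  · intro z hz z' hz' hs hx
    obtain ⟨hzO, hzV, hzs⟩ := hOsub hz
    obtain ⟨hzO', hzV', -⟩ := hOsub hz'
    refine ContinuousMap.map_eq_of_integralCurve
      (N := fun b => (⟨g b, (hg b).continuous⟩ : C(E, E)).comp) (s := z.1)
      (hint z hzO) ?_ R hx (by positivity) hzs (fun b t => ?_) 1
    · rw [hs]; exact hint z' hzO'
    · set y := φ z t
      set y' := φ z' t
      have hy := (hzV t).2
      have hy' := (hzV' t).2
      set m := R y' + (y - R y) with hm
      -- Since `R m = R y'`, the fields have the same `R`-part at `m` and `y'`, so `y'` may be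
      -- replaced by `m`. As `y - m = R (y - y')`, the Lipschitz bound involves the `R`-part only.
      have hmb : m ∈ Metric.ball p ρ := hV (a := (y, y')) ⟨(hzV t).1.1, (hzV' t).1.2⟩
      have hRm : R y' = R m := by simp [hm, hRR]
      have hgW : ∀ q ∈ Metric.ball p ρ, g b q = Z b q := fun q hq =>
        ((hball hq).2 b).1.eq_of_nhds
      have h1 : R (g b y') = R (g b m) := by
        rw [hgW _ hy', hgW _ hmb]
        exact hR b _ (hball hy').1 _ (hball hmb).1 hRm
      have h2 : ‖g b y - g b m‖ ≤ M * ‖y - m‖ :=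
        (convex_ball p ρ).norm_image_sub_le_of_norm_fderiv_le (𝕜 := ℝ)
          (fun x _ => (hg b).differentiable (by simp) x) (fun x hx => ((hball hx).2 b).2) hmb hy
      have h3 : y - m = R (y - y') := by rw [hm, map_sub]; abel
      calc ‖R (g b y - g b y')‖ = ‖R (g b y - g b m)‖ := by rw [map_sub, h1, ← map_sub]
        _ ≤ ‖R‖ * ‖g b y - g b m‖ := R.le_opNorm _
        _ ≤ (1 + ‖R‖) * (M * ‖R (y - y')‖) := by
          rw [← h3]
          gcongr
          linarith
        _ = _ := by ring

end CommutingFlow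

/-! ### Simultaneous straightening. -/

section NormalForm

variable {E Y : Type} [NormedAddCommGroup E] [NormedSpace ℝ E] [FiniteDimensional ℝ E]
  [NormedAddCommGroup Y] [NormedSpace ℝ Y] [FiniteDimensional ℝ Y]
  {β : Type} [Fintype β] [DecidableEq β]

lemma ContinuousLinearMap.ext_single {F : Type*} [NormedAddCommGroup F] [NormedSpace ℝ F]
    {f g : (β → ℝ) →L[ℝ] F} (h : ∀ b, f (Pi.single b 1) = g (Pi.single b 1)) : f = g := by
  apply ContinuousLinearMap.coe_injective
  exact LinearMap.pi_ext' fun b => LinearMap.ext_ring (by simpa using h b)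

/-- Commuting fields can be straightened simultaneously. If they project under `R`, then one part
`Q` of the new coordinates consists of functions on the image of `R`. -/
theorem exists_straightening {Z : β → E → E} {A : E → E} {U : Set E}
    (hU : IsOpen U) (hZ : ∀ b, ContDiffOn ℝ ∞ (Z b) U) (hA : ContinuousOn A U) {p : E} (hp : p ∈ U)
    (hcomm : ∀ b c, ∀ q ∈ U, VectorField.lieBracket ℝ (Z b) (Z c) q = 0)
    (R : E →L[ℝ] E) (hRR : ∀ x, R (R x) = R x)
    (hR : ∀ b, ∀ q ∈ U, ∀ q₂ ∈ U, R q = R q₂ → R (Z b q) = R (Z b q₂))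
    (M : (Y × (β → ℝ)) ≃L[ℝ] E) (hMZ : ∀ b, M (0, Pi.single b 1) = Z b p)
    (τ : Y →L[ℝ] ℝ) (hτ : τ (M.symm (A p)).1 ≠ 0)
    (Q : Y × (β → ℝ) →L[ℝ] Y × (β → ℝ)) (hQQ : ∀ z, Q (Q z) = Q z) (hQ2 : ∀ z, (Q z).2 = z.2)
    (hRQ : ∀ z, R (M z) = 0 ↔ Q z = 0) :
    ∃ Φ : OpenPartialHomeomorph E (Y × (β → ℝ)), p ∈ Φ.source ∧ Φ.source ⊆ U ∧
      ContDiffOn ℝ ∞ Φ Φ.source ∧ ContDiffOn ℝ ∞ Φ.symm Φ.target ∧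
      (∀ y, IsPreconnected {s | (y, s) ∈ Φ.target}) ∧
      (∀ b, ∀ q ∈ Φ.source, fderiv ℝ Φ q (Z b q) = (0, Pi.single b 1)) ∧
      (∀ q ∈ Φ.source, τ (fderiv ℝ Φ q (A q)).1 ≠ 0) ∧
      ∀ q ∈ Φ.source, ∀ q₂ ∈ Φ.source, R q = R q₂ → Q (Φ q) = Q (Φ q₂) := by
  obtain ⟨Ψ, O, hO, hpO, hΨ, hΨ0, hΨZ, hΨR⟩ := exists_commuting_flow hU hZ hp hcomm R hRR hR
  -- The inverse chart is `Θ (y, s) = Ψ (s, p + M (y, 0))`: the slice through `p` moved by the flow.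
  -- Its derivative at `0` is `M`: on the slice because `Ψ (0, ·)` is the identity, along `s`
  -- because `Ψ` has derivative `Z b p = M (0, e_b)`.
  let a' : Y × (β → ℝ) →L[ℝ] (β → ℝ) × E := (ContinuousLinearMap.snd ℝ Y (β → ℝ)).prod
    ((M : Y × (β → ℝ) →L[ℝ] E).comp ((ContinuousLinearMap.inl ℝ Y (β → ℝ)).comp
      (ContinuousLinearMap.fst ℝ Y (β → ℝ))))
  let a : Y × (β → ℝ) → (β → ℝ) × E := fun z => (0, p) + a' z
  have ha : ∀ z, a z = (z.2, p + M (z.1, 0)) := fun z => by simp [a, a']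
  have hasm : ContDiff ℝ ∞ a := contDiff_const.add a'.contDiff
  have ha' : ∀ z, HasFDerivAt a a' z := fun z => a'.hasFDerivAt.const_add _
  have ha0 : a 0 = (0, p) := by simp [a]
  set Θ : Y × (β → ℝ) → E := fun z => Ψ (a z) with hΘdef
  set O₁ := a ⁻¹' O with hO₁def
  have hO₁ : IsOpen O₁ := hO.preimage hasm.continuous
  have h0O₁ : (0 : Y × (β → ℝ)) ∈ O₁ := by rw [hO₁def, Set.mem_preimage, ha0]; exact hpO
  have hΘ : ContDiffOn ℝ ∞ Θ O₁ := hΨ.comp hasm.contDiffOn (fun z hz => hz)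
  have hΨd : ∀ w ∈ O, HasFDerivAt Ψ (fderiv ℝ Ψ w) w := fun w hw =>
    ((hΨ.contDiffAt (hO.mem_nhds hw)).differentiableAt (by simp)).hasFDerivAt
  have hΘd : ∀ z ∈ O₁, HasFDerivAt Θ ((fderiv ℝ Ψ (a z)).comp a') z := fun z hz =>
    (hΨd (a z) hz).comp z (ha' z)
  have hΘZ : ∀ z ∈ O₁, ∀ b, fderiv ℝ Θ z (0, Pi.single b 1) = Z b (Θ z) := by
    intro z hz b
    rw [(hΘd z hz).fderiv, ContinuousLinearMap.comp_apply]
    have : a' (0, Pi.single b 1) = (Pi.single b 1, 0) := by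
      simp [a', Prod.mk_zero_zero]
    rw [this, (hΨZ _ hz).2]
  have hΘ0 : Θ 0 = p := by rw [hΘdef]; simp only; rw [ha0]; exact hΨ0 p hpO
  have hΨx : ∀ x, fderiv ℝ Ψ (0, p) (0, x) = x := by
    intro x
    have h1 : HasFDerivAt (fun x => Ψ (0, x)) ((fderiv ℝ Ψ (0, p)).comp
        (ContinuousLinearMap.inr ℝ (β → ℝ) E)) p :=
      (hΨd _ hpO).comp p (hasFDerivAt_prodMk_right (0 : β → ℝ) p)
    have h2 : (fun x => Ψ (0, x)) =ᶠ[𝓝 p] id := by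
      have hc : Continuous fun x : E => ((0 : β → ℝ), x) := by fun_prop
      filter_upwards [(hO.preimage hc).mem_nhds hpO] with x hx
      exact hΨ0 x hx
    exact congrArg (fun L => L x) (h1.unique ((hasFDerivAt_id p).congr_of_eventuallyEq h2))
  have hΘM : HasFDerivAt Θ (M : Y × (β → ℝ) →L[ℝ] E) 0 := by
    have h1 := hΘd 0 h0O₁
    convert h1 using 1
    rw [ha0]
    apply ContinuousLinearMap.prod_ext
    · ext y
      simp [a', hΨx]
    · refine ContinuousLinearMap.ext_single fun b => ?_
      have := hΘZ 0 h0O₁ b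
      rw [h1.fderiv, hΘ0, ha0] at this
      simp only [ContinuousLinearMap.comp_apply, ContinuousLinearMap.inr_apply,
        ContinuousLinearEquiv.coe_coe] at this ⊢
      rw [this, hMZ]
  obtain ⟨e, h0e, heO₁, heΘ, hes, heL⟩ :=
    exists_openPartialHomeomorph_contDiffOn hO₁ hΘ h0O₁ M hΘM
  have he0 : e 0 = p := by rw [heΘ, hΘ0]
  have hsymm : ∀ z ∈ e.source, ∀ L : (Y × (β → ℝ)) ≃L[ℝ] E,
      HasFDerivAt Θ (L : Y × (β → ℝ) →L[ℝ] E) z → fderiv ℝ e.symm (e z) = L.symm := by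
    intro z hz L hL
    refine (e.hasFDerivAt_symm (e.map_source hz) ?_).fderiv
    rw [e.left_inv hz]
    exact hL.congr_of_eventuallyEq (Filter.Eventually.of_forall heΘ)
  have heU : ∀ q ∈ e.target, q ∈ U := by
    intro q hq
    have := (hΨZ _ (heO₁ (e.map_target hq))).1
    have h2 : Θ (e.symm q) = q := by rw [← heΘ, e.right_inv hq]
    rw [← h2]; exact this
  -- transversality
  have hT : ∀ᶠ z in 𝓝 (0 : Y × (β → ℝ)), τ (fderiv ℝ e.symm (e z) (A (e z))).1 ≠ 0 := by
    have hp' : p ∈ e.target := he0 ▸ e.map_source h0e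
    have hc1 : ContinuousAt (fun q => τ (fderiv ℝ e.symm q (A q)).1) p := by
      have h1 : ContinuousAt (fderiv ℝ e.symm) p :=
        (hes.continuousOn_fderiv_of_isOpen e.open_target (by simp)).continuousAt
          (e.open_target.mem_nhds hp')
      have h2 : ContinuousAt A p := hA.continuousAt (hU.mem_nhds hp)
      exact τ.continuous.continuousAt.comp (continuous_fst.continuousAt.comp (h1.clm_apply h2))
    have hc2 : ContinuousAt e 0 := e.continuousAt h0e
    have hc : ContinuousAt (fun z => τ (fderiv ℝ e.symm (e z) (A (e z))).1) 0 := by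
      rw [← he0] at hc1
      exact hc1.comp hc2
    refine hc.eventually_ne ?_
    rw [hsymm 0 h0e M hΘM, he0]
    exact hτ
  -- the part `Q` of the coordinates
  have hG : ∃ N ∈ 𝓝 (0 : Y × (β → ℝ)), ∀ z ∈ N, ∀ z₂ ∈ N, R (Θ z) = R (Θ z₂) → Q z = Q z₂ := by
    set B : E →L[ℝ] Y × (β → ℝ) := Q.comp ((M.symm : E →L[ℝ] Y × (β → ℝ)).comp R) with hB
    have hBM : ∀ z, B (M z) = Q z := by
      intro z
      have h1 : R (M (M.symm (R (M z)) - z)) = 0 := by simp [hRR]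
      have h2 := (hRQ _).1 h1
      rw [map_sub, sub_eq_zero] at h2
      exact h2
    -- Since `B ∘ M = Q`, this map has derivative `Q + (1 - Q) = 1` at `0` and is injective nearby.
    -- It sees `Θ z` only through `R`.
    have hG' : HasFDerivAt (fun z => B (Θ z) + (z - Q z))
        ((ContinuousLinearEquiv.refl ℝ (Y × (β → ℝ)) :
          (Y × (β → ℝ)) ≃L[ℝ] Y × (β → ℝ)) : Y × (β → ℝ) →L[ℝ] Y × (β → ℝ)) 0 := by
      refine ((B.hasFDerivAt.comp 0 hΘM).add
        ((hasFDerivAt_id _).sub Q.hasFDerivAt)).congr_fderiv ?_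
      refine ContinuousLinearMap.ext fun z => ?_
      simp [hBM]
    obtain ⟨g, h0g, hgO₁, hg, -, -⟩ := exists_openPartialHomeomorph_contDiffOn hO₁
      (f := fun z => B (Θ z) + (z - Q z))
      ((B.contDiff.comp_contDiffOn hΘ).add (contDiffOn_id.sub Q.contDiff.contDiffOn)) h0O₁ _ hG'
    have hmix : ∀ᶠ y : (Y × (β → ℝ)) × (Y × (β → ℝ)) in 𝓝 (0, 0),
        Q y.2 + (y.1 - Q y.1) ∈ g.source := by
      have hc : ContinuousAt (fun y : (Y × (β → ℝ)) × (Y × (β → ℝ)) => Q y.2 + (y.1 - Q y.1))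
        (0, 0) := by fun_prop
      exact hc.eventually_mem (by simpa using g.open_source.mem_nhds h0g)
    obtain ⟨V₁, hV₁, V₂, hV₂, hV⟩ := mem_nhds_prod_iff.1 hmix
    refine ⟨(V₁ ∩ V₂) ∩ g.source, Filter.inter_mem (Filter.inter_mem hV₁ hV₂)
      (g.open_source.mem_nhds h0g), fun z hz z₂ hz₂ hzz => ?_⟩
    -- The mixed point `m` has the `Q`-part of `z₂` and the complement of `z`. The flow respects
    -- `R`, so `R (Θ m) = R (Θ z₂) = R (Θ z)`. Then `g m = g z`, hence `m = z` and `Q z₂ = Q z`.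
    have hm : Q z₂ + (z - Q z) ∈ g.source := hV (a := (z, z₂)) ⟨hz.1.1, hz₂.1.2⟩
    set m := Q z₂ + (z - Q z) with hmdef
    have hQm : Q m = Q z₂ := by simp [hmdef, hQQ]
    have h1 : R (Θ m) = R (Θ z₂) := by
      refine hΨR _ (hgO₁ hm) _ (hgO₁ hz₂.2) ?_ ?_
      · rw [ha, ha]
        simp only
        rw [← hQ2 m, hQm, hQ2]
      · rw [ha, ha]
        simp only
        have h2 : Q (m.1 - z₂.1, (0 : β → ℝ)) = 0 := by
          have h3 : (m.1 - z₂.1, (0 : β → ℝ)) = m - z₂ := by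
            refine Prod.ext rfl ?_
            have : m.2 = z₂.2 := by rw [← hQ2 m, hQm, hQ2]
            simp [this]
          rw [h3, map_sub, hQm, sub_self]
        have h4 := (hRQ _).2 h2
        have h5 : (m.1 - z₂.1, (0 : β → ℝ)) = (m.1, 0) - (z₂.1, 0) := by simp
        rw [h5, map_sub, map_sub, sub_eq_zero] at h4
        rw [map_add, map_add, h4]
    have h6 : g m = g z := by
      rw [hg, hg]
      have h7 : B (Θ m) = B (Θ z) := by
        simp only [hB, ContinuousLinearMap.comp_apply]
        rw [h1, hzz]
      rw [h7, hQm, hmdef]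
      abel
    rw [← hQm, g.injOn hm hz.2 h6]
  obtain ⟨N, hN, hNQ⟩ := hG
  -- Restriction to a ball makes the fibres over `y` convex, hence preconnected.
  obtain ⟨r, hr, hball⟩ := Metric.mem_nhds_iff.1 (Filter.inter_mem (Filter.inter_mem
    (e.open_source.mem_nhds h0e) hT) hN)
  set e' := e.restrOpen (Metric.ball 0 r) Metric.isOpen_ball with he'
  have hsrc : e'.source = Metric.ball 0 r := by
    rw [he', e.restrOpen_source]
    exact Set.inter_eq_right.2 fun z hz => (hball hz).1.1
  have htgt : ∀ q ∈ e'.target, q ∈ e.target ∧ e.symm q ∈ Metric.ball (0 : Y × (β → ℝ)) r := by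
    intro q hq
    have h1 := e'.map_target hq
    rw [hsrc] at h1
    have h2 : e (e.symm q) = q := e'.right_inv hq
    exact ⟨h2 ▸ e.map_source (hball h1).1.1, h1⟩
  refine ⟨e'.symm, ?_, ?_, ?_, ?_, ?_, ?_, ?_, ?_⟩
  · have h1 : (0 : Y × (β → ℝ)) ∈ e'.source := by rw [hsrc]; exact Metric.mem_ball_self hr
    have := e'.map_source h1
    have h2 : e' 0 = p := he0
    rw [h2] at this
    exact this
  · exact fun q hq => heU q (htgt q hq).1
  · exact hes.mono fun q hq => (htgt q hq).1
  · rw [OpenPartialHomeomorph.symm_symm]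
    refine (hΘ.mono fun z hz => ?_).congr fun z _ => heΘ z
    rw [OpenPartialHomeomorph.symm_target, hsrc] at hz
    exact heO₁ (hball hz).1.1
  · intro y
    rw [OpenPartialHomeomorph.symm_target, hsrc]
    refine Convex.isPreconnected ?_
    have h1 := (convex_ball (0 : Y × (β → ℝ)) r)
    intro s hs s' hs' c c' hc hc' hcc
    have := h1 hs hs' hc hc' hcc
    simpa [← add_smul, hcc] using this
  · intro b q hq
    obtain ⟨hq1, hq2⟩ := htgt q hq
    obtain ⟨L, hL⟩ := heL _ (e.map_target hq1)
    have h1 : fderiv ℝ e.symm q = L.symm := by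
      have := hsymm _ (e.map_target hq1) L hL
      rwa [e.right_inv hq1] at this
    have h2 := hΘZ _ (heO₁ (e.map_target hq1)) b
    rw [hL.fderiv, ← heΘ, e.right_inv hq1] at h2
    change fderiv ℝ e.symm q (Z b q) = _
    rw [h1, ← h2]
    simp
  · intro q hq
    obtain ⟨hq1, hq2⟩ := htgt q hq
    have := (hball hq2).1.2
    rw [Set.mem_ofPred_eq, e.right_inv hq1] at this
    exact this
  · intro q hq q₂ hq₂ hqq
    obtain ⟨h1, h2⟩ := htgt q hq
    obtain ⟨h3, h4⟩ := htgt q₂ hq₂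
    refine hNQ _ (hball h2).2 _ (hball h4).2 ?_
    change R (Θ (e.symm q)) = R (Θ (e.symm q₂))
    rw [← heΘ, ← heΘ, e.right_inv h1, e.right_inv h3, hqq]

end NormalForm

/-! ### Linear algebra: a frame adapted to the coordinates in `J`. -/

section Frame

/-- Vectors that are independent in the subspace of the coordinates in `J` belong to a frame in
which this subspace is again a coordinate subspace. -/
lemma exists_adapted_frame {α β : Type} [Fintype α] [Fintype β] [DecidableEq β] (J : Set α)
    (v : Option β → α → ℝ) (hv : LinearIndependent ℝ (fun (o : Option β) (j : J) => v o j)) :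
    ∃ (m : ℕ) (M : ((Option (Fin m) → ℝ) × (β → ℝ)) ≃L[ℝ] (α → ℝ)) (K : Set (Option (Fin m))),
      none ∈ K ∧ K.ncard + Fintype.card β = J.ncard ∧ M (Pi.single none 1, 0) = v none ∧
      (∀ b, M (0, Pi.single b 1) = v (some b)) ∧
      ∀ y s, (∀ j ∈ J, M (y, s) j = 0) ↔ (∀ k ∈ K, y k = 0) ∧ s = 0 := by
  classical
  obtain ⟨X, _, bJ, hbJ⟩ : ∃ (X : Type) (_ : Fintype X)
      (bJ : Module.Basis (Option β ⊕ X) ℝ (J → ℝ)),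
      ∀ o, bJ (Sum.inl o) = fun j : J => v o j := by
    have hfin := Module.Finite.finite_basis (Module.Basis.sumExtend hv)
    have := Finite.sum_right (α := Option β) (β := Module.Basis.sumExtendIndex hv)
    exact ⟨_, Fintype.ofFinite _, Module.Basis.sumExtend hv, fun o => by
      simp only [Module.Basis.sumExtend, Module.Basis.reindex_apply, Module.Basis.extend_apply_self]
      rfl⟩
  let m := Fintype.card (X ⊕ (Jᶜ : Set α))
  let e : Fin m ≃ X ⊕ (Jᶜ : Set α) := (Fintype.equivFin _).symm
  -- The basis vectors completing `v` within `J → ℝ`, extended by zero, and the unit vectors of the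
  -- coordinates outside `J`. The latter vanish on `J`, so there `M₀` is just the expansion in the
  -- basis `bJ`.
  let f : X ⊕ (Jᶜ : Set α) → α → ℝ := Sum.elim
    (fun x a => if h : a ∈ J then bJ (Sum.inr x) ⟨a, h⟩ else 0) (fun j => Pi.single (j : α) 1)
  let u : Option (Fin m) → α → ℝ := fun k => k.elim (v none) (fun i => f (e i))
  let M₀ : (Option (Fin m) → ℝ) × (β → ℝ) →ₗ[ℝ] (α → ℝ) :=
    (Fintype.linearCombination ℝ u).coprod (Fintype.linearCombination ℝ fun b => v (some b))
  have hM₀ : ∀ y s a, M₀ (y, s) a = y none * v none a + ∑ b, s b * v (some b) a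
      + ((∑ x, y (some (e.symm (Sum.inl x))) * f (Sum.inl x) a)
        + ∑ j, y (some (e.symm (Sum.inr j))) * f (Sum.inr j) a) := by
    intro y s a
    have h1 : ∑ i, y (some i) * f (e i) a
        = (∑ x, y (some (e.symm (Sum.inl x))) * f (Sum.inl x) a)
          + ∑ j, y (some (e.symm (Sum.inr j))) * f (Sum.inr j) a := by
      rw [← Equiv.sum_comp e.symm, Fintype.sum_sum_type]
      simp
    simp only [M₀, LinearMap.coprod_apply, Fintype.linearCombination_apply, Fintype.sum_option,
      Pi.add_apply, Finset.sum_apply, Pi.smul_apply, smul_eq_mul]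
    rw [← h1]
    simp only [u, Option.elim]
    ring
  let coef : (Option (Fin m) → ℝ) → (β → ℝ) → Option β ⊕ X → ℝ := fun y s =>
    Sum.elim (fun o => o.elim (y none) s) (fun x => y (some (e.symm (Sum.inl x))))
  have hJ : ∀ y s (j : J), M₀ (y, s) j = (∑ i, coef y s i • bJ i) j := by
    intro y s j
    have h1 : ∑ j', y (some (e.symm (Sum.inr j'))) * f (Sum.inr j') (j : α) = 0 := by
      refine Finset.sum_eq_zero fun j' _ => ?_
      have : (j : α) ≠ j' := fun h => j'.2 (h ▸ j.2)
      simp [f, this]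
    rw [hM₀, h1, add_zero]
    simp [coef, f, hbJ]
  have hJ0 : ∀ y s, (∀ j ∈ J, M₀ (y, s) j = 0) ↔
      (y none = 0 ∧ ∀ x, y (some (e.symm (Sum.inl x))) = 0) ∧ s = 0 := by
    intro y s
    have h1 : (∀ j ∈ J, M₀ (y, s) j = 0) ↔ ∑ i, coef y s i • bJ i = 0 := by
      constructor
      · intro h
        ext j
        rw [← hJ, h j j.2]; rfl
      · intro h j hj
        rw [hJ y s ⟨j, hj⟩, h]; rfl
    rw [h1]
    constructor
    · intro h
      have h2 := Fintype.linearIndependent_iff.1 bJ.linearIndependent _ h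
      exact ⟨⟨h2 (Sum.inl none), fun x => h2 (Sum.inr x)⟩,
        funext fun b => h2 (Sum.inl (some b))⟩
    · rintro ⟨⟨h2, h3⟩, rfl⟩
      refine Finset.sum_eq_zero fun i _ => ?_
      have : coef y 0 i = 0 := by
        rcases i with (_ | b) | x
        · exact h2
        · rfl
        · exact h3 x
      rw [this, zero_smul]
  have hinj : Function.Injective M₀ := by
    rw [← LinearMap.ker_eq_bot, LinearMap.ker_eq_bot']
    rintro ⟨y, s⟩ h
    obtain ⟨⟨h1, h2⟩, rfl⟩ := (hJ0 y s).1 fun j _ => by rw [h]; rfl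
    refine Prod.ext (funext fun k => ?_) rfl
    rcases k with _ | i
    · exact h1
    · obtain ⟨x | j, rfl⟩ := e.symm.surjective i
      · exact h2 x
      · have h3 := hM₀ y 0 j
        rw [h] at h3
        simp only [h1, h2] at h3
        rw [Finset.sum_eq_single j (fun j' _ hj' => by
          have : (j : α) ≠ j' := fun h => hj' (Subtype.ext h.symm)
          simp [f, this]) (by simp)] at h3
        simpa [f] using h3.symm
  have hcardJ : Fintype.card J = Fintype.card β + 1 + Fintype.card X := by
    have := Module.finrank_eq_card_basis bJ
    simpa using this
  have hdim : Module.finrank ℝ ((Option (Fin m) → ℝ) × (β → ℝ)) = Module.finrank ℝ (α → ℝ) := by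
    have h1 : m = Fintype.card X + Fintype.card (Jᶜ : Set α) := by simp [m]
    have h2 : Fintype.card J + Fintype.card (Jᶜ : Set α) = Fintype.card α := by
      rw [← Fintype.card_sum]; exact Fintype.card_congr (Equiv.Set.sumCompl J)
    simp only [Module.finrank_prod, Module.finrank_fintype_fun_eq_card, Fintype.card_option,
      Fintype.card_fin]
    omega
  let M₁ := LinearEquiv.ofInjectiveOfFinrankEq M₀ hinj hdim
  -- `K` consists of `none`, for the operator, and the positions of the vectors from `X`.
  let g : Option X → Option (Fin m) := Option.map fun x => e.symm (Sum.inl x)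
  have hg : Function.Injective g :=
    Option.map_injective (e.symm.injective.comp Sum.inl_injective)
  refine ⟨m, M₁.toContinuousLinearEquiv, Set.range g, ⟨none, rfl⟩, ?_, ?_, ?_, ?_⟩
  · rw [Set.ncard_range_of_injective hg, ← Nat.card_coe_set_eq, Nat.card_eq_fintype_card,
      Nat.card_eq_fintype_card, hcardJ, Fintype.card_option]
    ring
  · change M₀ _ = _
    simp [M₀, u, Fintype.linearCombination_apply_single]
  · intro b
    change M₀ _ = _
    simp [M₀, Fintype.linearCombination_apply_single]
  · intro y s
    refine (hJ0 y s).trans (and_congr_left' ?_)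
    rw [Set.forall_mem_range, Option.forall]
    rfl

end Frame

section CoordProj

open Classical in
/-- The projection which replaces the coordinates with index outside `J` by zero. -/
noncomputable def coordProj {α : Type*} (J : Set α) : (α → ℝ) →L[ℝ] (α → ℝ) :=
  ContinuousLinearMap.pi fun j => if j ∈ J then ContinuousLinearMap.proj j else 0

variable {α : Type*} {J : Set α} {x y : α → ℝ}

lemma coordProj_apply_of_mem {j : α} (hj : j ∈ J) : coordProj J x j = x j := by
  simp [coordProj, hj]

lemma coordProj_apply_of_notMem {j : α} (hj : j ∉ J) : coordProj J x j = 0 := by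
  simp [coordProj, hj]

lemma coordProj_eq_iff : coordProj J x = coordProj J y ↔ ∀ j ∈ J, x j = y j := by
  refine ⟨fun h j hj => ?_, fun h => funext fun j => ?_⟩
  · rw [← coordProj_apply_of_mem (x := x) hj, h, coordProj_apply_of_mem hj]
  · by_cases hj : j ∈ J
    · rw [coordProj_apply_of_mem hj, coordProj_apply_of_mem hj, h j hj]
    · rw [coordProj_apply_of_notMem hj, coordProj_apply_of_notMem hj]

lemma coordProj_eq_zero_iff : coordProj J x = 0 ↔ ∀ j ∈ J, x j = 0 := by
  rw [← map_zero (coordProj J), coordProj_eq_iff]; rfl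

lemma coordProj_coordProj : coordProj J (coordProj J x) = coordProj J x :=
  coordProj_eq_iff.2 fun _ hj => coordProj_apply_of_mem hj

end CoordProj

/-- Commuting generators that act transitively in a subspace can be brought to normal form by new
coordinates of this subspace. -/
theorem NormalChart.exists_isOver {r : ℕ} {S : Stage r} {C : Fin r → Fin r → Fin r → ℝ}
    (hS : S.IsSymmetric C) {B : Finset (Fin r)} {p : Phase S.ι} (hp : p ∈ S.dom)
    (hB : ∀ a ∈ B, ∀ d ∈ B, ∀ q ∈ S.dom, VectorField.lieBracket ℝ (S.Z a) (S.Z d) q = 0)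
    {J : Set (Option S.ι)} (hJ : S.ActsTransitively B J p) :
    ∃ (m : ℕ) (c : NormalChart S B (Fin m)), p ∈ c.Φ.source ∧ c.IsOver J := by
  obtain ⟨⟨O, hO, hOJ⟩, hind⟩ := hJ
  obtain ⟨m, M, K, hK, hcard, hMA, hMZ, hMK⟩ := exists_adapted_frame (β := B) J
    (fun o => o.elim (S.A p) fun a => S.Z a p) hind
  have hU : IsOpen (S.dom ∩ interior O) := hS.isOpen_dom.inter isOpen_interior
  have hUO : ∀ q ∈ S.dom ∩ interior O, q ∈ O := fun q hq => interior_subset hq.2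
  obtain ⟨Φ, hpΦ, hΦU, hΦ, hΦs, hfib, hΦZ, hΦA, hΦQ⟩ := exists_straightening
    (Z := fun b : B => S.Z b) (A := S.A) hU (fun b => (hS.smooth_Z b).mono Set.inter_subset_left)
    (hS.smooth_A.continuousOn.mono Set.inter_subset_left)
    (p := p) ⟨hp, mem_interior_iff_mem_nhds.2 hO⟩
    (fun b c q hq => hB b b.2 c c.2 q hq.1)
    (coordProj J) (fun x => coordProj_coordProj)
    (fun b q hq q₂ hq₂ h => coordProj_eq_iff.2 (hOJ q (hUO q hq) q₂ (hUO q₂ hq₂)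
      (coordProj_eq_iff.1 h) b b.2)) M hMZ (ContinuousLinearMap.proj none)
    (by
      -- The frame sends the `t`-direction to `A` at `p`, which gives transversality there.
      have : M.symm (S.A p) = (Pi.single none 1, 0) := by
        rw [ContinuousLinearEquiv.symm_apply_eq]; exact hMA.symm
      simp [this])
    ((coordProj K).prodMap (ContinuousLinearMap.id ℝ (B → ℝ)))
    (fun z => Prod.ext coordProj_coordProj rfl) (fun z => rfl)
    (fun z => by
      rw [coordProj_eq_zero_iff, hMK, ← coordProj_eq_zero_iff, Prod.ext_iff]; rfl)
  refine ⟨m, ⟨Φ, hΦU.trans Set.inter_subset_left, hΦ, hΦs, hfib, hΦZ, hΦA⟩, hpΦ, K, hK, ?_, ?_⟩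
  · rw [← hcard, Fintype.card_coe]
  · intro q hq q₂ hq₂ h
    have h1 := hΦQ q hq q₂ hq₂ (coordProj_eq_iff.2 h)
    have h2 : (Φ q).2 = (Φ q₂).2 := (Prod.ext_iff.1 h1).2
    exact ⟨h2, coordProj_eq_iff.1 (Prod.ext_iff.1 h1).1⟩

/-! ### Brackets of related fields. -/

section LieBracket

variable {E F : Type*} [NormedAddCommGroup E] [NormedSpace ℝ E] [NormedAddCommGroup F]
  [NormedSpace ℝ F]

lemma minSmoothness_two_le_infty : minSmoothness ℝ 2 ≤ (∞ : WithTop ℕ∞) := by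
  rw [minSmoothness_of_isRCLikeNormedField]
  exact ENat.LEInfty.out

/-- Lie brackets of related vector fields are related. -/
lemma fderiv_lieBracket_of_related {π : E → F} {V W : E → E} {V' W' : F → F} {p : E}
    (hπ : ContDiffAt ℝ ∞ π p) (hV : DifferentiableAt ℝ V p) (hW : DifferentiableAt ℝ W p)
    (hV' : DifferentiableAt ℝ V' (π p)) (hW' : DifferentiableAt ℝ W' (π p))
    (hVV' : ∀ᶠ q in 𝓝 p, fderiv ℝ π q (V q) = V' (π q))
    (hWW' : ∀ᶠ q in 𝓝 p, fderiv ℝ π q (W q) = W' (π q)) :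
    fderiv ℝ π p (VectorField.lieBracket ℝ V W p) = VectorField.lieBracket ℝ V' W' (π p) := by
  have hd : HasFDerivAt π (fderiv ℝ π p) p := (hπ.differentiableAt (by simp)).hasFDerivAt
  rw [VectorField.fderiv_apply_lieBracket hπ minSmoothness_two_le_infty hW hV]
  have h1 : (fun x => fderiv ℝ π x (W x)) =ᶠ[𝓝 p] W' ∘ π := hWW'
  have h2 : (fun x => fderiv ℝ π x (V x)) =ᶠ[𝓝 p] V' ∘ π := hVV'
  rw [h1.fderiv_eq, h2.fderiv_eq, (hW'.hasFDerivAt.comp p hd).fderiv,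
    (hV'.hasFDerivAt.comp p hd).fderiv, ContinuousLinearMap.comp_apply,
    ContinuousLinearMap.comp_apply, hVV'.self_of_nhds, hWW'.self_of_nhds]
  rfl

end LieBracket

section Normalized

variable {α : Type*} [Fintype α]

/-- If a field `A` with constant component `1` is mapped to a multiple of itself by the bracket
with `Z`, then the factor is determined by the component of `Z` in this direction. -/
lemma lieBracket_eq_neg_fderiv_smul {Z A : (Option α → ℝ) → Option α → ℝ} {p : Option α → ℝ}
    (hZ : DifferentiableAt ℝ Z p) (hA : DifferentiableAt ℝ A p)
    (hA1 : ∀ᶠ q in 𝓝 p, A q none = 1) {ν : ℝ} (h : VectorField.lieBracket ℝ Z A p = ν • A p) :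
    VectorField.lieBracket ℝ Z A p = -(fderiv ℝ (fun q => Z q none) p (A p)) • A p := by
  have h1 : fderiv ℝ A p (Z p) none = 0 := by
    have h2 := hasFDerivAt_pi'.1 hA.hasFDerivAt none
    have h3 : (fun q => A q none) =ᶠ[𝓝 p] fun _ => 1 := hA1
    exact congrArg (fun L => L (Z p)) (h2.unique
      ((hasFDerivAt_const (1 : ℝ) p).congr_of_eventuallyEq h3))
  have h4 : fderiv ℝ Z p (A p) none = fderiv ℝ (fun q => Z q none) p (A p) := by
    rw [(hasFDerivAt_pi'.1 hZ.hasFDerivAt none).fderiv]; rfl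
  have h5 := congrFun h none
  rw [VectorField.lieBracket, Pi.sub_apply, h1, h4, Pi.smul_apply, hA1.self_of_nhds, smul_eq_mul,
    mul_one, zero_sub] at h5
  rw [h, ← h5]

end Normalized

/-! ### Reduction in a chart with the normal form. -/

namespace NormalChart

variable {r : ℕ} {S : Stage r} {B : Finset (Fin r)} {κ : Type} [Fintype κ]
  (c : NormalChart S B κ)

lemma contDiffAt {p : Phase S.ι} (hp : p ∈ c.Φ.source) : ContDiffAt ℝ ∞ c.Φ p :=
  c.smooth.contDiffAt (c.Φ.open_source.mem_nhds hp)

lemma contDiffAt_symm {z : Phase κ × (B → ℝ)} (hz : z ∈ c.Φ.target) :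
    ContDiffAt ℝ ∞ c.Φ.symm z :=
  c.smooth_symm.contDiffAt (c.Φ.open_target.mem_nhds hz)

lemma hasFDerivAt {p : Phase S.ι} (hp : p ∈ c.Φ.source) :
    HasFDerivAt c.Φ (fderiv ℝ c.Φ p) p :=
  ((c.contDiffAt hp).differentiableAt (by simp)).hasFDerivAt

lemma hasFDerivAt_symm {z : Phase κ × (B → ℝ)} (hz : z ∈ c.Φ.target) :
    HasFDerivAt c.Φ.symm (fderiv ℝ c.Φ.symm z) z :=
  ((c.contDiffAt_symm hz).differentiableAt (by simp)).hasFDerivAt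

lemma fderiv_symm_fderiv {p : Phase S.ι} (hp : p ∈ c.Φ.source) (v : Phase S.ι) :
    fderiv ℝ c.Φ.symm (c.Φ p) (fderiv ℝ c.Φ p v) = v := by
  have h1 := (c.hasFDerivAt_symm (c.Φ.map_source hp)).comp p (c.hasFDerivAt hp)
  have h2 : c.Φ.symm ∘ c.Φ =ᶠ[𝓝 p] id := c.Φ.eventually_left_inverse hp
  exact congrArg (fun L => L v) (h1.unique ((hasFDerivAt_id p).congr_of_eventuallyEq h2))

lemma fderiv_fderiv_symm {p : Phase S.ι} (hp : p ∈ c.Φ.source) (w : Phase κ × (B → ℝ)) :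
    fderiv ℝ c.Φ p (fderiv ℝ c.Φ.symm (c.Φ p) w) = w := by
  have h0 : HasFDerivAt c.Φ (fderiv ℝ c.Φ p) (c.Φ.symm (c.Φ p)) := by
    rw [c.Φ.left_inv hp]; exact c.hasFDerivAt hp
  have h1 := h0.comp (c.Φ p) (c.hasFDerivAt_symm (c.Φ.map_source hp))
  have h2 : c.Φ ∘ c.Φ.symm =ᶠ[𝓝 (c.Φ p)] id := c.Φ.eventually_right_inverse (c.Φ.map_source hp)
  exact congrArg (fun L => L w) (h1.unique ((hasFDerivAt_id _).congr_of_eventuallyEq h2))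

/-- The reduction by a chart lowers the number of variables by the number of generators used. -/
lemma card_add_card {p : Phase S.ι} (hp : p ∈ c.Φ.source) :
    Fintype.card κ + B.card = Fintype.card S.ι := by
  let e : Phase S.ι ≃ₗ[ℝ] Phase κ × (B → ℝ) := LinearEquiv.ofLinearMap
    (fderiv ℝ c.Φ p : Phase S.ι →ₗ[ℝ] Phase κ × (B → ℝ))
    (fderiv ℝ c.Φ.symm (c.Φ p) : Phase κ × (B → ℝ) →ₗ[ℝ] Phase S.ι)
    (LinearMap.ext fun w => c.fderiv_fderiv_symm hp w)
    (LinearMap.ext fun v => c.fderiv_symm_fderiv hp v)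
  have h := e.finrank_eq
  simp only [Phase, Module.finrank_prod, Module.finrank_fintype_fun_eq_card, Fintype.card_option,
    Fintype.card_coe] at h
  omega

/-- A smooth function on the domain of the chart that factors through the coordinates `(t, w)`
is smooth in these. -/
lemma contDiffOn_of_eq_comp {G : Type*} [NormedAddCommGroup G] [NormedSpace ℝ G]
    {f : Phase S.ι → G} {g : Phase κ → G} (hf : ContDiffOn ℝ ∞ f c.Φ.source)
    (h : ∀ p ∈ c.Φ.source, f p = g (c.Φ p).1) : ContDiffOn ℝ ∞ g (Prod.fst '' c.Φ.target) := by
  rintro _ ⟨⟨q, s⟩, hz, rfl⟩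
  refine ContDiffAt.contDiffWithinAt ?_
  have hs : Continuous fun q' : Phase κ => (q', s) := by fun_prop
  have h1 : ContDiffAt ℝ ∞ (fun q' => f (c.Φ.symm (q', s))) q := by
    have h2 : ContDiffAt ℝ ∞ f (c.Φ.symm (q, s)) :=
      hf.contDiffAt (c.Φ.open_source.mem_nhds (c.Φ.map_target hz))
    have h3 : ContDiffAt ℝ ∞ (fun q' : Phase κ => c.Φ.symm (q', s)) q :=
      (c.contDiffAt_symm hz).comp q (contDiffAt_id.prodMk contDiffAt_const)
    exact h2.comp q h3
  refine h1.congr_of_eventuallyEq ?_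
  filter_upwards [(c.Φ.open_target.preimage hs).mem_nhds hz] with q' hq'
  rw [h _ (c.Φ.map_target hq'), c.Φ.right_inv hq']

/-- A function that is constant along the generators in `B` factors through the coordinates
`(t, w)`. -/
lemma exists_eq_comp {G : Type*} [NormedAddCommGroup G] [NormedSpace ℝ G]
    {f : Phase S.ι → G} (hf : ContDiffOn ℝ ∞ f c.Φ.source)
    (h : ∀ p ∈ c.Φ.source, ∀ d : B, fderiv ℝ f p (S.Z d p) = 0) :
    ∃ g : Phase κ → G, ∀ p ∈ c.Φ.source, f p = g (c.Φ p).1 := by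
  classical
  have hconst : ∀ q, ∀ s, (q, s) ∈ c.Φ.target → ∀ s', (q, s') ∈ c.Φ.target →
      f (c.Φ.symm (q, s)) = f (c.Φ.symm (q, s')) := by
    intro q s hs s' hs'
    have hq : Continuous fun s : B → ℝ => (q, s) := by fun_prop
    have hd : ∀ x ∈ {s | (q, s) ∈ c.Φ.target}, HasFDerivAt (fun s => f (c.Φ.symm (q, s)))
        (0 : (B → ℝ) →L[ℝ] G) x := by
      intro x hx
      have hx' := c.Φ.map_target hx
      have h1 : HasFDerivAt f (fderiv ℝ f (c.Φ.symm (q, x))) (c.Φ.symm (q, x)) :=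
        ((hf.contDiffAt (c.Φ.open_source.mem_nhds hx')).differentiableAt (by simp)).hasFDerivAt
      have h2 := h1.comp x ((c.hasFDerivAt_symm hx).comp x (hasFDerivAt_prodMk_right q x))
      refine h2.congr_fderiv (ContinuousLinearMap.ext_single fun d => ?_)
      have h3 := c.fderiv_symm_fderiv hx' (S.Z d (c.Φ.symm (q, x)))
      rw [c.normal d _ hx', c.Φ.right_inv hx] at h3
      simp only [ContinuousLinearMap.comp_apply, ContinuousLinearMap.inr_apply]
      rw [h3, h _ hx' d]
      rfl
    -- The derivatives along the fibre are those along the generators in `B`, so they vanish;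
    -- preconnectedness of the fibre gives constancy.
    exact (c.Φ.open_target.preimage hq).is_const_of_fderiv_eq_zero (c.fibre q)
      (fun x hx => (hd x hx).differentiableAt.differentiableWithinAt)
      (fun x hx => (hd x hx).fderiv) hs hs'
  -- The value `0` is taken only off the projection of the target, where nothing is claimed.
  refine ⟨fun q => if h : ∃ s, (q, s) ∈ c.Φ.target then f (c.Φ.symm (q, h.choose)) else 0,
    fun p hp => ?_⟩
  have hp' : ((c.Φ p).1, (c.Φ p).2) ∈ c.Φ.target := c.Φ.map_source hp
  have hex : ∃ s, ((c.Φ p).1, s) ∈ c.Φ.target := ⟨_, hp'⟩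
  simp only [dif_pos hex]
  rw [hconst _ _ hex.choose_spec _ hp']
  exact congrArg f (c.Φ.left_inv hp).symm

/-- The derivative of the coordinates along a smooth field is smooth. -/
lemma contDiffOn_fderiv_apply {V : Phase S.ι → Phase S.ι} (hV : ContDiffOn ℝ ∞ V c.Φ.source) :
    ContDiffOn ℝ ∞ (fun p => fderiv ℝ c.Φ p (V p)) c.Φ.source :=
  (c.smooth.fderiv_of_isOpen c.Φ.open_source (by simp)).clm_apply hV

/-- In the chart, the bracket with a generator in `B` is a partial derivative. -/
lemma fderiv_lieBracket_eq {V : Phase S.ι → Phase S.ι} {p : Phase S.ι} (hp : p ∈ c.Φ.source)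
    (hV : DifferentiableAt ℝ V p) (d : B) (hZ : DifferentiableAt ℝ (S.Z d) p) :
    fderiv ℝ c.Φ p (VectorField.lieBracket ℝ (S.Z d) V p)
      = fderiv ℝ (fun p => fderiv ℝ c.Φ p (V p)) p (S.Z d p) := by
  have h1 : (fun p => fderiv ℝ c.Φ p (S.Z d p)) =ᶠ[𝓝 p]
      fun _ => ((0 : Phase κ), (Pi.single d 1 : B → ℝ)) :=
    Filter.eventually_of_mem (c.Φ.open_source.mem_nhds hp) fun q hq => c.normal d q hq
  rw [VectorField.fderiv_apply_lieBracket (c.contDiffAt hp) minSmoothness_two_le_infty hV hZ,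
    h1.fderiv_eq, fderiv_fun_const]
  simp

/-- The operator of the system with `t` as the parameter. -/
noncomputable def normalizedOperator (p : Phase S.ι) : Phase S.ι :=
  ((fderiv ℝ c.Φ p (S.A p)).1 none)⁻¹ • S.A p

lemma fderiv_normalizedOperator_none {p : Phase S.ι} (hp : p ∈ c.Φ.source) :
    (fderiv ℝ c.Φ p (c.normalizedOperator p)).1 none = 1 := by
  simp only [normalizedOperator, map_smul, Prod.smul_fst, Pi.smul_apply, smul_eq_mul]
  exact inv_mul_cancel₀ (c.transversal p hp)

variable {C : Fin r → Fin r → Fin r → ℝ}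

lemma contDiffOn_scale (hS : S.IsSymmetric C) :
    ContDiffOn ℝ ∞ (fun p => ((fderiv ℝ c.Φ p (S.A p)).1 none)⁻¹) c.Φ.source := by
  refine ContDiffOn.inv ?_ c.transversal
  exact (contDiff_apply ℝ ℝ none).comp_contDiffOn (contDiff_fst.comp_contDiffOn
    (c.contDiffOn_fderiv_apply (hS.smooth_A.mono c.source_subset)))

lemma contDiffOn_normalizedOperator (hS : S.IsSymmetric C) :
    ContDiffOn ℝ ∞ c.normalizedOperator c.Φ.source :=
  (c.contDiffOn_scale hS).smul (hS.smooth_A.mono c.source_subset)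

lemma differentiableAt_Z (hS : S.IsSymmetric C) {p : Phase S.ι} (hp : p ∈ c.Φ.source) (a : Fin r) :
    DifferentiableAt ℝ (S.Z a) p :=
  ((hS.smooth_Z a).contDiffAt (hS.isOpen_dom.mem_nhds (c.source_subset hp))).differentiableAt
    (by simp)

lemma differentiableAt_normalizedOperator (hS : S.IsSymmetric C) {p : Phase S.ι}
    (hp : p ∈ c.Φ.source) : DifferentiableAt ℝ c.normalizedOperator p :=
  ((c.contDiffOn_normalizedOperator hS).contDiffAt
    (c.Φ.open_source.mem_nhds hp)).differentiableAt (by simp)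

/-- In `[Z, f A] = Z(f) A + f [Z, A]` both terms are multiples of `A`, which is itself a multiple of
the scaled operator. -/
lemma exists_lieBracket_normalizedOperator_eq (hS : S.IsSymmetric C) {p : Phase S.ι}
    (hp : p ∈ c.Φ.source) (a : Fin r) :
    ∃ ν : ℝ, VectorField.lieBracket ℝ (S.Z a) c.normalizedOperator p
      = ν • c.normalizedOperator p := by
  have h1 : DifferentiableAt ℝ (fun p => ((fderiv ℝ c.Φ p (S.A p)).1 none)⁻¹) p :=
    ((c.contDiffOn_scale hS).contDiffAt (c.Φ.open_source.mem_nhds hp)).differentiableAt (by simp)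
  have h2 : DifferentiableAt ℝ S.A p :=
    (hS.smooth_A.contDiffAt (hS.isOpen_dom.mem_nhds (c.source_subset hp))).differentiableAt
      (by simp)
  have h3 := VectorField.lieBracket_smul_right (V := S.Z a) h1 h2
  have hA : S.A p = ((fderiv ℝ c.Φ p (S.A p)).1 none) • c.normalizedOperator p := by
    rw [normalizedOperator, smul_inv_smul₀ (c.transversal p hp)]
  rw [hS.symm a p (c.source_subset hp), smul_smul, ← add_smul] at h3
  rw [hA, smul_smul] at h3
  exact ⟨_, h3⟩

/-- If the brackets of the generators in `B` with all generators are combinations of generators in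
`B`, then the system and all its generators reduce in any chart with the normal form. -/
theorem exists_isReduction (hS : S.IsSymmetric C)
    (hB : ∀ d ∈ B, ∀ a, ∀ p ∈ S.dom, ∃ k : Fin r → ℝ,
      VectorField.lieBracket ℝ (S.Z d) (S.Z a) p = ∑ e ∈ B, k e • S.Z e p) :
    ∃ domT AT ZT, c.IsReduction domT AT ZT := by
  have hZ : ∀ a, ∃ g : Phase κ → Phase κ, ∀ p ∈ c.Φ.source,
      (fderiv ℝ c.Φ p (S.Z a p)).1 = g (c.Φ p).1 := by
    intro a
    have hf := c.contDiffOn_fderiv_apply ((hS.smooth_Z a).mono c.source_subset)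
    refine c.exists_eq_comp (contDiff_fst.comp_contDiffOn hf) fun p hp d => ?_
    have h1 : DifferentiableAt ℝ (fun p => fderiv ℝ c.Φ p (S.Z a p)) p :=
      (hf.contDiffAt (c.Φ.open_source.mem_nhds hp)).differentiableAt (by simp)
    -- The derivative of the `(t,w)`-part along `Z d` is the `(t,w)`-part of the bracket, a
    -- combination of fields `∂_s`, so it vanishes.
    obtain ⟨k, hk⟩ := hB d d.2 a p (c.source_subset hp)
    have h2 := c.fderiv_lieBracket_eq hp (c.differentiableAt_Z hS hp a) d
      (c.differentiableAt_Z hS hp d)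
    rw [hk, map_sum] at h2
    refine (congrArg (fun L => L (S.Z d p))
      (hasFDerivAt_fst.comp p h1.hasFDerivAt).fderiv).trans ?_
    rw [ContinuousLinearMap.comp_apply, ← h2]
    simp only [ContinuousLinearMap.coe_fst', Prod.fst_sum, map_smul, Prod.smul_fst]
    refine Finset.sum_eq_zero fun e he => ?_
    rw [c.normal ⟨e, he⟩ p hp, smul_zero]
  have hA : ∃ g : Phase κ → Phase κ × (B → ℝ), ∀ p ∈ c.Φ.source,
      fderiv ℝ c.Φ p (c.normalizedOperator p) = g (c.Φ p).1 := by
    have hf := c.contDiffOn_fderiv_apply (c.contDiffOn_normalizedOperator hS)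
    refine c.exists_eq_comp hf fun p hp d => ?_
    have h1 : HasFDerivAt (fun p => fderiv ℝ c.Φ p (c.normalizedOperator p)) _ p :=
      ((hf.contDiffAt (c.Φ.open_source.mem_nhds hp)).differentiableAt (by simp)).hasFDerivAt
    obtain ⟨ν, hν⟩ := c.exists_lieBracket_normalizedOperator_eq hS hp d
    have h2 := c.fderiv_lieBracket_eq hp (c.differentiableAt_normalizedOperator hS hp) d
      (c.differentiableAt_Z hS hp d)
    rw [hν, map_smul] at h2
    have h3 : HasFDerivAt (fun p => (fderiv ℝ c.Φ p (c.normalizedOperator p)).1 none)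
        ((ContinuousLinearMap.proj none).comp ((ContinuousLinearMap.fst ℝ _ _).comp
          (fderiv ℝ (fun p => fderiv ℝ c.Φ p (c.normalizedOperator p)) p))) p :=
      ((ContinuousLinearMap.proj (R := ℝ) (φ := fun _ : Option κ => ℝ) none).comp
        (ContinuousLinearMap.fst ℝ (Phase κ) (B → ℝ))).hasFDerivAt.comp p h1
    have h4 : (fun p => (fderiv ℝ c.Φ p (c.normalizedOperator p)).1 none) =ᶠ[𝓝 p] fun _ => 1 :=
      Filter.eventually_of_mem (c.Φ.open_source.mem_nhds hp) fun q hq =>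
        c.fderiv_normalizedOperator_none hq
    have h5 := congrArg (fun L => L (S.Z d p)) (h3.unique
      ((hasFDerivAt_const (1 : ℝ) p).congr_of_eventuallyEq h4))
    simp only [ContinuousLinearMap.comp_apply] at h5
    rw [← h2] at h5
    -- The `t`-component is constantly `1`; its derivative along `Z d` is `0`, but also `ν * 1`.
    have h6 : ν = 0 := by
      have h7 := c.fderiv_normalizedOperator_none hp
      simpa [h7] using h5
    rw [← h2, h6, zero_smul]
  choose ZT hZT using hZ
  obtain ⟨g, hg⟩ := hA
  refine ⟨_, fun q => (g q).1, ZT, rfl, ⟨fun q => (g q).2, ?_, fun p hp => ?_⟩, hZT⟩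
  · exact contDiff_snd.comp_contDiffOn (c.contDiffOn_of_eq_comp
      (c.contDiffOn_fderiv_apply (c.contDiffOn_normalizedOperator hS)) hg)
  · have h1 : ((g (c.Φ p).1).1, (g (c.Φ p).1).2) = g (c.Φ p).1 := rfl
    rw [h1, ← hg p hp, normalizedOperator, map_smul, smul_inv_smul₀ (c.transversal p hp)]

variable {c} in
/-- A reduced system is again a system with symmetries, with the same structure constants. -/
theorem IsReduction.isSymmetric {domT : Set (Phase κ)} {AT : Phase κ → Phase κ}
    {ZT : Fin r → Phase κ → Phase κ} (hT : c.IsReduction domT AT ZT) (hS : S.IsSymmetric C) :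
    (Stage.mk κ domT AT ZT : Stage r).IsSymmetric C := by
  obtain ⟨u, hu, hop⟩ := hT.operator
  have hdom : IsOpen domT := by
    rw [hT.dom_eq]; exact isOpenMap_fst _ c.Φ.open_target
  have hnorm : ∀ p ∈ c.Φ.source, fderiv ℝ c.Φ p (c.normalizedOperator p)
      = (AT (c.Φ p).1, u (c.Φ p).1) := by
    intro p hp
    rw [normalizedOperator, map_smul, hop p hp]
    have h1 := congrArg (fun z : Phase κ × (B → ℝ) => z.1 none) (hop p hp)
    -- The `t`-component of the reduction identity reads `A(t) = A(t) * AT none`, so the reduced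
    -- operator is automatically normalized.
    have h2 : AT (c.Φ p).1 none = 1 := by
      simp only [Prod.smul_fst, Pi.smul_apply, smul_eq_mul] at h1
      exact (mul_eq_left₀ (c.transversal p hp)).1 h1.symm
    simp only [Prod.smul_mk, Pi.smul_apply, smul_eq_mul, h2, mul_one]
    rw [inv_smul_smul₀ (c.transversal p hp), inv_smul_smul₀ (c.transversal p hp)]
  have hAT : ContDiffOn ℝ ∞ AT domT := by
    rw [hT.dom_eq]
    refine c.contDiffOn_of_eq_comp (contDiff_fst.comp_contDiffOn
      (c.contDiffOn_fderiv_apply (c.contDiffOn_normalizedOperator hS))) fun p hp => ?_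
    exact congrArg Prod.fst (hnorm p hp)
  have hZT : ∀ a, ContDiffOn ℝ ∞ (ZT a) domT := by
    intro a
    rw [hT.dom_eq]
    exact c.contDiffOn_of_eq_comp (contDiff_fst.comp_contDiffOn
      (c.contDiffOn_fderiv_apply ((hS.smooth_Z a).mono c.source_subset)))
      fun p hp => hT.generators a p hp
  have hsurj : ∀ q ∈ domT, ∃ p ∈ c.Φ.source, (c.Φ p).1 = q := by
    intro q hq
    rw [hT.dom_eq] at hq
    obtain ⟨z, hz, rfl⟩ := hq
    exact ⟨_, c.Φ.map_target hz, by rw [c.Φ.right_inv hz]⟩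
  have hπ : ∀ p ∈ c.Φ.source, ContDiffAt ℝ ∞ (fun p => (c.Φ p).1) p := fun p hp =>
    contDiffAt_fst.comp p (c.contDiffAt hp)
  have hπ' : ∀ p ∈ c.Φ.source, ∀ v, fderiv ℝ (fun p => (c.Φ p).1) p v = (fderiv ℝ c.Φ p v).1 :=
    fun p hp v => congrArg (fun L => L v) (hasFDerivAt_fst.comp p (c.hasFDerivAt hp)).fderiv
  have hATd : ∀ q ∈ domT, DifferentiableAt ℝ AT q := fun q hq =>
    (hAT.contDiffAt (hdom.mem_nhds hq)).differentiableAt (by simp)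
  have hZTd : ∀ a, ∀ q ∈ domT, DifferentiableAt ℝ (ZT a) q := fun a q hq =>
    ((hZT a).contDiffAt (hdom.mem_nhds hq)).differentiableAt (by simp)
  have hrelZ : ∀ a, ∀ p ∈ c.Φ.source, ∀ᶠ q in 𝓝 p,
      fderiv ℝ (fun p => (c.Φ p).1) q (S.Z a q) = ZT a (c.Φ q).1 := fun a p hp =>
    Filter.eventually_of_mem (c.Φ.open_source.mem_nhds hp) fun q hq => by
      rw [hπ' q hq, hT.generators a q hq]
  have hrelA : ∀ p ∈ c.Φ.source, ∀ᶠ q in 𝓝 p,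
      fderiv ℝ (fun p => (c.Φ p).1) q (c.normalizedOperator q) = AT (c.Φ q).1 := fun p hp =>
    Filter.eventually_of_mem (c.Φ.open_source.mem_nhds hp) fun q hq => by
      rw [hπ' q hq, hnorm q hq]
  have hA1 : ∀ q ∈ domT, AT q none = 1 := by
    intro q hq
    obtain ⟨p, hp, rfl⟩ := hsurj q hq
    have := c.fderiv_normalizedOperator_none hp
    rwa [hnorm p hp] at this
  refine ⟨hdom, hAT, hZT, hA1, fun a q hq => ?_, fun a d q hq => ?_⟩
  · obtain ⟨p, hp, rfl⟩ := hsurj q hq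
    obtain ⟨ν, hν⟩ := c.exists_lieBracket_normalizedOperator_eq hS hp a
    refine lieBracket_eq_neg_fderiv_smul (hZTd a _ hq) (hATd _ hq)
      (Filter.eventually_of_mem (hdom.mem_nhds hq) hA1) (ν := ν) ?_
    change VectorField.lieBracket ℝ (ZT a) AT _ = ν • AT _
    rw [← (hrelA p hp).self_of_nhds]
    have := fderiv_lieBracket_of_related (hπ p hp) (c.differentiableAt_Z hS hp a)
      (c.differentiableAt_normalizedOperator hS hp) (hZTd a _ hq) (hATd _ hq) (hrelZ a p hp)
      (hrelA p hp)
    refine this.symm.trans ?_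
    rw [hν, map_smul]
  · obtain ⟨p, hp, rfl⟩ := hsurj q hq
    have := fderiv_lieBracket_of_related (hπ p hp) (c.differentiableAt_Z hS hp a)
      (c.differentiableAt_Z hS hp d) (hZTd a _ hq) (hZTd d _ hq) (hrelZ a p hp) (hrelZ d p hp)
    refine this.symm.trans ?_
    rw [hS.bracket a d p (c.source_subset hp), map_sum]
    refine Finset.sum_congr rfl fun e _ => ?_
    rw [map_smul, (hrelZ e p hp).self_of_nhds]

variable {c} in
/-- Generators that vanish, and those used in the reduction, have zero reductions. -/
lemma IsReduction.generator_eq_zero {domT : Set (Phase κ)} {AT : Phase κ → Phase κ}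
    {ZT : Fin r → Phase κ → Phase κ} (hT : c.IsReduction domT AT ZT) {a : Fin r}
    (ha : a ∈ B ∨ ∀ p ∈ S.dom, S.Z a p = 0) {q : Phase κ} (hq : q ∈ domT) : ZT a q = 0 := by
  rw [hT.dom_eq] at hq
  obtain ⟨z, hz, rfl⟩ := hq
  have hp := c.Φ.map_target hz
  have h := hT.generators a _ hp
  rw [c.Φ.right_inv hz] at h
  rw [← h]
  rcases ha with ha | ha
  · rw [c.normal ⟨a, ha⟩ _ hp]
  · rw [ha _ (c.source_subset hp), map_zero]; rfl

end NormalChart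

/-- If the brackets of two fields with `A` are multiples of `A`, then so is the bracket of their
bracket with `A`. -/
lemma exists_lieBracket_lieBracket_eq_smul {E : Type*} [NormedAddCommGroup E] [NormedSpace ℝ E]
    {U V A : E → E} {f g : E → ℝ} {p : E} (hU : ContDiffAt ℝ ∞ U p) (hV : ContDiffAt ℝ ∞ V p)
    (hA : ContDiffAt ℝ ∞ A p) (hf : DifferentiableAt ℝ f p) (hg : DifferentiableAt ℝ g p)
    (hUA : ∀ᶠ q in 𝓝 p, VectorField.lieBracket ℝ U A q = f q • A q)
    (hVA : ∀ᶠ q in 𝓝 p, VectorField.lieBracket ℝ V A q = g q • A q) :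
    ∃ μ : ℝ, VectorField.lieBracket ℝ (VectorField.lieBracket ℝ U V) A p = μ • A p := by
  -- Jacobi: `[[U,V],A] = [U, gA] - [V, fA]`, and each term on the right is a multiple of `A`.
  have h := VectorField.leibniz_identity_lieBracket minSmoothness_two_le_infty hU hV hA
  have hAd : DifferentiableAt ℝ A p := hA.differentiableAt (by simp)
  have h1 : VectorField.lieBracket ℝ U (VectorField.lieBracket ℝ V A) p
      = VectorField.lieBracket ℝ U (fun q => g q • A q) p :=
    Filter.EventuallyEq.lieBracket_vectorField_eq Filter.EventuallyEq.rfl hVA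
  have h2 : VectorField.lieBracket ℝ V (VectorField.lieBracket ℝ U A) p
      = VectorField.lieBracket ℝ V (fun q => f q • A q) p :=
    Filter.EventuallyEq.lieBracket_vectorField_eq Filter.EventuallyEq.rfl hUA
  rw [h1, h2, VectorField.lieBracket_smul_right hg hAd, VectorField.lieBracket_smul_right hf hAd,
    hUA.self_of_nhds, hVA.self_of_nhds, smul_smul, smul_smul, ← add_smul, ← add_smul,
    ← sub_eq_iff_eq_add, ← sub_smul] at h
  exact ⟨_, h.symm⟩

/-! ### Prolongations and their commutation relations. -/

namespace ODESystem

variable {N : ℕ} (E : ODESystem N)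

/-- The projection to the space of variables as a linear map. -/
def projCLM : Phase E.Jet →L[ℝ] Phase (Fin N) :=
  ContinuousLinearMap.pi fun o => match o with
    | none => ContinuousLinearMap.proj none
    | some k => ContinuousLinearMap.proj (some ⟨k, 0, E.one_le_ord k⟩)

lemma projCLM_apply (p : Phase E.Jet) : E.projCLM p = E.proj p := by
  funext o
  rcases o with _ | k <;> rfl

lemma isOpen_base : IsOpen E.base := by
  have hsurj : Function.Surjective E.projCLM := by
    intro y
    refine ⟨fun o => match o with
      | none => y none
      | some i => y (some i.1), funext fun o => ?_⟩
    rcases o with _ | k <;> rfl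
  have h := E.projCLM.isOpenMap hsurj _ E.isOpen_dom
  have : E.base = E.projCLM '' E.dom := Set.image_congr fun p _ => (E.projCLM_apply p).symm
  rwa [this]

lemma contDiff_proj : ContDiff ℝ ∞ E.proj := by
  have h : ContDiff ℝ ∞ E.projCLM := E.projCLM.contDiff
  rwa [show (E.projCLM : Phase E.Jet → Phase (Fin N)) = E.proj from funext E.projCLM_apply] at h

lemma contDiffOn_jet (k : Fin N) (l : ℕ) : ContDiffOn ℝ ∞ (E.jet k l) E.dom := by
  unfold jet
  split_ifs with h
  · exact (contDiff_apply ℝ ℝ _).contDiffOn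
  · exact E.smooth_rhs k

lemma contDiffOn_A : ContDiffOn ℝ ∞ E.A E.dom := by
  refine contDiffOn_pi.2 fun o => ?_
  rcases o with _ | i
  · exact contDiffOn_const
  · exact E.contDiffOn_jet i.1 (i.2 + 1)

variable {E} {V : Phase (Fin N) → Phase (Fin N)}

lemma contDiffOn_comp_proj (hV : ContDiffOn ℝ ∞ V E.base) (o : Option (Fin N)) :
    ContDiffOn ℝ ∞ (fun p => V (E.proj p) o) E.dom :=
  (contDiff_apply ℝ ℝ o).comp_contDiffOn
    (hV.comp E.contDiff_proj.contDiffOn fun p hp => ⟨p, hp, rfl⟩)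

/-- The total derivative of a smooth function is smooth. -/
lemma contDiffOn_fderiv_A {f : Phase E.Jet → ℝ} (hf : ContDiffOn ℝ ∞ f E.dom) :
    ContDiffOn ℝ ∞ (fun p => fderiv ℝ f p (E.A p)) E.dom :=
  (hf.fderiv_of_isOpen E.isOpen_dom (by simp)).clm_apply E.contDiffOn_A

lemma contDiffOn_prolongCoeff (hV : ContDiffOn ℝ ∞ V E.base) (k : Fin N) (l : ℕ) :
    ContDiffOn ℝ ∞ (E.prolongCoeff V k l) E.dom := by
  induction l with
  | zero => exact contDiffOn_comp_proj hV _
  | succ l ih =>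
    exact (contDiffOn_fderiv_A ih).sub ((E.contDiffOn_jet k (l + 1)).mul
      (contDiffOn_fderiv_A (contDiffOn_comp_proj hV none)))

lemma contDiffOn_prolong (hV : ContDiffOn ℝ ∞ V E.base) :
    ContDiffOn ℝ ∞ (E.prolong V) E.dom := by
  refine contDiffOn_pi.2 fun o => ?_
  rcases o with _ | i
  · exact contDiffOn_comp_proj hV none
  · exact contDiffOn_prolongCoeff hV i.1 i.2

lemma projCLM_prolong (p : Phase E.Jet) : E.projCLM (E.prolong V p) = V (E.proj p) := by
  funext o
  rcases o with _ | k <;> rfl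

/-- A field that commutes with the operator of the system up to a multiple of the operator is
determined by its projection to the space of variables. -/
lemma eq_zero_of_projCLM_eq_zero {W : Phase E.Jet → Phase E.Jet}
    (hW : ContDiffOn ℝ ∞ W E.dom) (h0 : ∀ p ∈ E.dom, E.projCLM (W p) = 0)
    (hA : ∀ p ∈ E.dom, ∃ μ : ℝ, VectorField.lieBracket ℝ W E.A p = μ • E.A p)
    {p : Phase E.Jet} (hp : p ∈ E.dom) : W p = 0 := by
  have hWd : ∀ p ∈ E.dom, HasFDerivAt W (fderiv ℝ W p) p := fun p hp =>
    ((hW.contDiffAt (E.isOpen_dom.mem_nhds hp)).differentiableAt (by simp)).hasFDerivAt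
  have hAd : ∀ p ∈ E.dom, HasFDerivAt E.A (fderiv ℝ E.A p) p := fun p hp =>
    ((E.contDiffOn_A.contDiffAt (E.isOpen_dom.mem_nhds hp)).differentiableAt
      (by simp)).hasFDerivAt
  have hcomp : ∀ o, (∀ p ∈ E.dom, W p o = 0) → ∀ p ∈ E.dom, ∀ v, fderiv ℝ W p v o = 0 := by
    intro o ho p hp v
    have h1 := hasFDerivAt_pi'.1 (hWd p hp) o
    have h2 : (fun q => W q o) =ᶠ[𝓝 p] fun _ => 0 :=
      Filter.eventually_of_mem (E.isOpen_dom.mem_nhds hp) ho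
    exact congrArg (fun L => L v) (h1.unique
      ((hasFDerivAt_const (0 : ℝ) p).congr_of_eventuallyEq h2))
  have hnone : ∀ p ∈ E.dom, W p none = 0 := fun p hp => congrFun (h0 p hp) none
  -- The `x`-component of the bracket vanishes while that of `A` is `1`, so `μ = 0` and `W` commutes
  -- with `A`.
  have hcommute : ∀ p ∈ E.dom, fderiv ℝ E.A p (W p) = fderiv ℝ W p (E.A p) := by
    intro p hp
    obtain ⟨μ, hμ⟩ := hA p hp
    have h1 := congrFun hμ none
    have h2 : fderiv ℝ E.A p (W p) none = 0 := by
      have h3 := hasFDerivAt_pi'.1 (hAd p hp) none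
      exact congrArg (fun L => L (W p)) (h3.unique (hasFDerivAt_const (1 : ℝ) p))
    rw [VectorField.lieBracket, Pi.sub_apply, h2, hcomp none hnone p hp, sub_zero] at h1
    have h4 : μ = 0 := by
      have : (μ • E.A p) none = μ * 1 := rfl
      rw [this, mul_one] at h1
      exact h1.symm
    rw [h4, zero_smul, VectorField.lieBracket, sub_eq_zero] at hμ
    exact hμ
  have hsome : ∀ (k : Fin N) (l : ℕ) (hl : l < E.ord k), ∀ p ∈ E.dom,
      W p (some ⟨k, l, hl⟩) = 0 := by
    intro k l
    induction l with
    | zero => exact fun hl p hp => congrFun (h0 p hp) (some k)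
    | succ l ih =>
      intro hl p hp
      have hl' : l < E.ord k := by omega
      -- The `(k, l)`-component of `A` is the coordinate `(k, l + 1)`, so commuting gives `W_{k,l+1}
      -- = A(W_{k,l}) = 0`.
      have h1 := congrFun (hcommute p hp) (some ⟨k, l, hl'⟩)
      rw [hcomp _ (ih hl') p hp] at h1
      have h2 := hasFDerivAt_pi'.1 (hAd p hp) (some ⟨k, l, hl'⟩)
      have h3 : (fun q => E.A q (some ⟨k, l, hl'⟩)) = fun q => q (some ⟨k, l + 1, hl⟩) := by
        funext q
        exact dif_pos hl
      rw [h3] at h2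
      have h4 := congrArg (fun L => L (W p)) (h2.unique (ContinuousLinearMap.proj (R := ℝ)
        (φ := fun _ : Option E.Jet => ℝ) (some ⟨k, l + 1, hl⟩)).hasFDerivAt)
      exact h4.symm.trans h1
  funext o
  rcases o with _ | ⟨k, l, hl⟩
  · exact hnone p hp
  · exact hsome k l hl p hp

/-- Prolonged symmetry generators satisfy the commutation relations of the original ones. -/
lemma lieBracket_prolong {r : ℕ} {X : Fin r → Phase (Fin N) → Phase (Fin N)}
    {C : Fin r → Fin r → Fin r → ℝ} (hX : ∀ a, E.IsPointSymmetry (X a))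
    (hC : ∀ a c, ∀ q ∈ E.base, VectorField.lieBracket ℝ (X a) (X c) q = ∑ e, C a c e • X e q)
    (a c : Fin r) {p : Phase E.Jet} (hp : p ∈ E.dom) :
    VectorField.lieBracket ℝ (E.prolong (X a)) (E.prolong (X c)) p
      = ∑ e, C a c e • E.prolong (X e) p := by
  have hZ : ∀ a, ContDiffOn ℝ ∞ (E.prolong (X a)) E.dom := fun a => contDiffOn_prolong (hX a).1
  have hZa : ∀ a, ∀ p ∈ E.dom, ContDiffAt ℝ ∞ (E.prolong (X a)) p := fun a p hp =>
    (hZ a).contDiffAt (E.isOpen_dom.mem_nhds hp)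
  have hZd : ∀ a, ∀ p ∈ E.dom, DifferentiableAt ℝ (E.prolong (X a)) p := fun a p hp =>
    (hZa a p hp).differentiableAt (by simp)
  have hL : ∀ p ∈ E.dom, ContDiffAt ℝ ∞
      (VectorField.lieBracket ℝ (E.prolong (X a)) (E.prolong (X c))) p := fun p hp =>
    ContDiffAt.lieBracket_vectorField (hZa a p hp) (hZa c p hp) (by simp)
  have hS : ContDiffOn ℝ ∞ (fun p => ∑ e, C a c e • E.prolong (X e) p) E.dom :=
    ContDiffOn.sum fun e _ => contDiffOn_const.fun_smul (hZ e)
  -- The defect of the commutation relations. It projects to zero by `hC`, and by Jacobi and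
  -- linearity its bracket with `A` is a multiple of `A`.
  set W : Phase E.Jet → Phase E.Jet := fun p =>
    VectorField.lieBracket ℝ (E.prolong (X a)) (E.prolong (X c)) p
      - ∑ e, C a c e • E.prolong (X e) p
  suffices W p = 0 from sub_eq_zero.1 this
  refine eq_zero_of_projCLM_eq_zero (ContDiffOn.sub (fun p hp => (hL p hp).contDiffWithinAt) hS)
    (fun p hp => ?_) (fun p hp => ?_) hp
  · have hb : E.proj p ∈ E.base := ⟨p, hp, rfl⟩
    have hXd : ∀ a, DifferentiableAt ℝ (X a) (E.projCLM p) := fun a => by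
      rw [projCLM_apply]
      exact ((hX a).1.contDiffAt (E.isOpen_base.mem_nhds hb)).differentiableAt (by simp)
    have hrel : ∀ a, ∀ᶠ q in 𝓝 p, fderiv ℝ E.projCLM q (E.prolong (X a) q)
        = X a (E.projCLM q) := fun a => Filter.Eventually.of_forall fun q => by
      rw [ContinuousLinearMap.fderiv, projCLM_prolong, projCLM_apply]
    have h1 := fderiv_lieBracket_of_related E.projCLM.contDiff.contDiffAt (hZd a p hp)
      (hZd c p hp) (hXd a) (hXd c) (hrel a) (hrel c)
    rw [ContinuousLinearMap.fderiv, E.projCLM_apply p, hC a c _ hb] at h1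
    rw [map_sub, h1, map_sum, sub_eq_zero]
    exact Finset.sum_congr rfl fun e _ => by rw [map_smul, projCLM_prolong]
  · let f : Fin r → Phase E.Jet → ℝ := fun a p =>
      -(fderiv ℝ (fun q => X a (E.proj q) none) p (E.A p))
    have hf : ∀ a, DifferentiableAt ℝ (f a) p := fun a =>
      ((contDiffOn_fderiv_A (contDiffOn_comp_proj (hX a).1 none)).neg.contDiffAt
        (E.isOpen_dom.mem_nhds hp)).differentiableAt (by simp)
    have hfA : ∀ a, ∀ᶠ q in 𝓝 p, VectorField.lieBracket ℝ (E.prolong (X a)) E.A q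
        = f a q • E.A q := fun a =>
      Filter.eventually_of_mem (E.isOpen_dom.mem_nhds hp) (hX a).2
    obtain ⟨μ, hμ⟩ := exists_lieBracket_lieBracket_eq_smul (hZa a p hp) (hZa c p hp)
      (E.contDiffOn_A.contDiffAt (E.isOpen_dom.mem_nhds hp)) (hf a) (hf c) (hfA a) (hfA c)
    have hWd : HasFDerivAt W (fderiv ℝ
        (VectorField.lieBracket ℝ (E.prolong (X a)) (E.prolong (X c))) p
        - ∑ e, C a c e • fderiv ℝ (E.prolong (X e)) p) p :=
      ((hL p hp).differentiableAt (by simp)).hasFDerivAt.sub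
        (HasFDerivAt.fun_sum fun e _ => (hZd e p hp).hasFDerivAt.const_smul (C a c e))
    refine ⟨μ - ∑ e, C a c e * f e p, ?_⟩
    have h1 : ∑ e, (C a c e * f e p) • E.A p
        = ∑ e, C a c e • (fderiv ℝ E.A p (E.prolong (X e) p)
          - fderiv ℝ (E.prolong (X e)) p (E.A p)) := by
      refine Finset.sum_congr rfl fun e _ => ?_
      rw [mul_smul, ← (hfA e).self_of_nhds, VectorField.lieBracket]
    have h2 : VectorField.lieBracket ℝ (VectorField.lieBracket ℝ (E.prolong (X a))
        (E.prolong (X c))) E.A p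
      = fderiv ℝ E.A p (VectorField.lieBracket ℝ (E.prolong (X a)) (E.prolong (X c)) p)
        - fderiv ℝ (VectorField.lieBracket ℝ (E.prolong (X a)) (E.prolong (X c))) p (E.A p) := rfl
    rw [sub_smul, ← hμ, Finset.sum_smul, h1, VectorField.lieBracket, hWd.fderiv, h2]
    simp only [map_sub, map_sum, map_smul, sub_apply, sum_apply, smul_apply, smul_sub,
      Finset.sum_sub_distrib]
    abel

/-- The system with the prolonged generators of a symmetry algebra. -/
lemma toStage_isSymmetric {r : ℕ} {X : Fin r → Phase (Fin N) → Phase (Fin N)}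
    {C : Fin r → Fin r → Fin r → ℝ} (hX : ∀ a, E.IsPointSymmetry (X a))
    (hC : ∀ a c, ∀ q ∈ E.base, VectorField.lieBracket ℝ (X a) (X c) q = ∑ e, C a c e • X e q) :
    (E.toStage X).IsSymmetric C where
  isOpen_dom := E.isOpen_dom
  smooth_A := E.contDiffOn_A
  smooth_Z a := contDiffOn_prolong (hX a).1
  A_none _ _ := rfl
  symm a p hp := (hX a).2 p hp
  bracket a c _ hp := lieBracket_prolong hX hC a c hp

end ODESystem

/-! ### Structure constants in a basis adapted to the derived series. -/

section DerivedSeries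

variable {L : Type*} [LieRing L] [LieAlgebra ℝ L] {r n : ℕ} {b : Module.Basis (Fin r) ℝ L}

lemma mem_coset {i j : ℕ} {a : Fin r} : a ∈ coset b i j ↔
    b a ∈ LieAlgebra.derivedSeries ℝ L i ∧ b a ∉ LieAlgebra.derivedSeries ℝ L j := by
  simp [coset]

lemma derivedSeries_le {i j : ℕ} (h : i ≤ j) :
    LieAlgebra.derivedSeries ℝ L j ≤ LieAlgebra.derivedSeries ℝ L i :=
  LieAlgebra.derivedSeriesOfIdeal_antitone _ h

/-- The coordinates of an element of a derived algebra belong to basis elements in it. -/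
lemma IsAdapted.mem_of_repr_ne_zero (hb : IsAdapted b) {k : ℕ} {x : L}
    (hx : x ∈ LieAlgebra.derivedSeries ℝ L k) {e : Fin r} (he : b.repr x e ≠ 0) :
    b e ∈ LieAlgebra.derivedSeries ℝ L k := by
  have h := hb k x hx
  have h1 : {y | ∃ a, b a = y ∧ b a ∈ LieAlgebra.derivedSeries ℝ L k}
      = b '' {a | b a ∈ LieAlgebra.derivedSeries ℝ L k} := by
    ext y
    constructor
    · rintro ⟨a, rfl, ha⟩
      exact ⟨a, ha, rfl⟩
    · rintro ⟨a, ha, rfl⟩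
      exact ⟨a, rfl, ha⟩
  rw [h1, b.mem_span_image] at h
  exact h (Finset.mem_coe.2 (Finsupp.mem_support_iff.2 he))

/-- Derived algebras are ideals. -/
lemma IsAdapted.mem_of_structConst_ne_zero (hb : IsAdapted b) {k : ℕ} {a d e : Fin r}
    (ha : b a ∈ LieAlgebra.derivedSeries ℝ L k) (he : structConst b a d e ≠ 0) :
    b e ∈ LieAlgebra.derivedSeries ℝ L k :=
  hb.mem_of_repr_ne_zero (lie_mem_left ℝ L _ _ _ ha) he

lemma IsAdapted.mem_succ_of_structConst_ne_zero (hb : IsAdapted b) {k : ℕ} {a d e : Fin r}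
    (ha : b a ∈ LieAlgebra.derivedSeries ℝ L k) (hd : b d ∈ LieAlgebra.derivedSeries ℝ L k)
    (he : structConst b a d e ≠ 0) : b e ∈ LieAlgebra.derivedSeries ℝ L (k + 1) := by
  refine hb.mem_of_repr_ne_zero ?_ he
  rw [LieAlgebra.derivedSeries_def, LieAlgebra.derivedSeriesOfIdeal_succ]
  exact LieSubmodule.lie_mem_lie ha hd

lemma IsLevelSolvable.notMem (hL : IsLevelSolvable L n) (e : Fin r) :
    b e ∉ LieAlgebra.derivedSeries ℝ L n := by
  rw [hL.1, LieSubmodule.mem_bot]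
  exact b.ne_zero e

lemma mem_coset_zero {j : ℕ} {a : Fin r} :
    a ∈ coset b 0 j ↔ b a ∉ LieAlgebra.derivedSeries ℝ L j := by
  rw [mem_coset, LieAlgebra.derivedSeries_def, LieAlgebra.derivedSeriesOfIdeal_zero]
  exact and_iff_right (LieSubmodule.mem_top _)

lemma IsLevelSolvable.coset_zero (hL : IsLevelSolvable L n) : coset b 0 n = Finset.univ :=
  Finset.eq_univ_of_forall fun a => mem_coset_zero.2 (hL.notMem a)

lemma mem_coset_iff_of_le {i j k : ℕ} (hij : i ≤ j) (hjk : j ≤ k) {a : Fin r} :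
    a ∈ coset b i k ↔ a ∈ coset b i j ∨ a ∈ coset b j k := by
  have h1 : b a ∈ LieAlgebra.derivedSeries ℝ L j → b a ∈ LieAlgebra.derivedSeries ℝ L i :=
    fun h => derivedSeries_le hij h
  have h2 : b a ∈ LieAlgebra.derivedSeries ℝ L k → b a ∈ LieAlgebra.derivedSeries ℝ L j :=
    fun h => derivedSeries_le hjk h
  rw [mem_coset, mem_coset, mem_coset]
  tauto

lemma card_coset_add {i j k : ℕ} (hij : i ≤ j) (hjk : j ≤ k) :
    (coset b i j).card + (coset b j k).card = (coset b i k).card := by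
  classical
  rw [← Finset.card_union_of_disjoint]
  · congr 1
    ext a
    rw [Finset.mem_union, mem_coset_iff_of_le hij hjk]
  · refine Finset.disjoint_left.2 fun a ha ha' => ?_
    exact (mem_coset.1 ha).2 (mem_coset.1 ha').1

end DerivedSeries

/-! ### Invariants of the method and its steps. -/

section Stages

variable {L : Type*} [LieRing L] [LieAlgebra ℝ L] {r n : ℕ} {b : Module.Basis (Fin r) ℝ L}

/-- The properties of the system and its generators that persist in the first integration
method. -/
theorem FirstIntegration.invariants {S₀ : Stage r} {p₀ : Phase S₀.ι}
    (hL : IsLevelSolvable L n) (hS₀ : S₀.IsSymmetric (structConst b)) {k : ℕ} {S : Stage r}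
    {p : Phase S.ι} (h : FirstIntegration b n S₀ p₀ k S p) :
    k ≤ n ∧ p ∈ S.dom ∧ S.IsSymmetric (structConst b) ∧
      (∀ a ∈ coset b (n - k) n, ∀ q ∈ S.dom, S.Z a q = 0) ∧
      Fintype.card S.ι + (coset b (n - k) n).card = Fintype.card S₀.ι := by
  induction h with
  | start hp =>
    have h0 : coset b (n - 0) n = ∅ :=
      Finset.eq_empty_of_forall_notMem fun a ha => hL.notMem a (mem_coset.1 ha).1
    refine ⟨Nat.zero_le n, hp, hS₀, ?_, ?_⟩
    · rw [h0]; simp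
    · rw [h0]; simp
  | @step k S p h hk κ _ c hp domT AT ZT hT ih =>
    obtain ⟨-, -, hS, hzero, hcard⟩ := ih
    refine ⟨hk, ?_, hT.isSymmetric hS, fun a ha q hq => ?_, ?_⟩
    · change (c.Φ p).1 ∈ domT
      rw [hT.dom_eq]
      exact ⟨_, c.Φ.map_source hp, rfl⟩
    · refine hT.generator_eq_zero ?_ hq
      -- A vanishing generator is either in the coset just used or was already zero.
      exact ((mem_coset_iff_of_le (by omega) (Nat.sub_le n k)).1 ha).imp_right (hzero a)
    · have h1 := c.card_add_card hp
      have h2 := card_coset_add (b := b) (show n - (k + 1) ≤ n - k by omega) (Nat.sub_le n k)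
      change Fintype.card κ + _ = _
      omega

variable {k : ℕ} {S : Stage r}

lemma Stage.generator_eq_zero_of_mem (hL : IsLevelSolvable L n)
    (hzero : ∀ a ∈ coset b (n - k) n, ∀ q ∈ S.dom, S.Z a q = 0) {e : Fin r}
    (he : b e ∈ LieAlgebra.derivedSeries ℝ L (n - k)) {q : Phase S.ι} (hq : q ∈ S.dom) :
    S.Z e q = 0 :=
  hzero e (mem_coset.2 ⟨he, hL.notMem e⟩) q hq

lemma Stage.lieBracket_eq_sum_coset (hL : IsLevelSolvable L n)
    (hS : S.IsSymmetric (structConst b))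
    (hzero : ∀ a ∈ coset b (n - k) n, ∀ q ∈ S.dom, S.Z a q = 0) (a d : Fin r)
    {q : Phase S.ι} (hq : q ∈ S.dom) :
    VectorField.lieBracket ℝ (S.Z a) (S.Z d) q
      = ∑ e ∈ coset b 0 (n - k), structConst b a d e • S.Z e q := by
  rw [hS.bracket a d q hq]
  refine (Finset.sum_subset (Finset.subset_univ _) fun e _ he => ?_).symm
  rw [mem_coset_zero, not_not] at he
  rw [Stage.generator_eq_zero_of_mem hL hzero he hq, smul_zero]

/-- The bracket lies in the next derived algebra `g^(n-k)`, whose generators have already become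
zero. -/
lemma Stage.lieBracket_eq_zero (hL : IsLevelSolvable L n) (hb : IsAdapted b) (hk : k < n)
    (hS : S.IsSymmetric (structConst b))
    (hzero : ∀ a ∈ coset b (n - k) n, ∀ q ∈ S.dom, S.Z a q = 0) {a d : Fin r}
    (ha : a ∈ coset b (n - (k + 1)) (n - k)) (hd : d ∈ coset b (n - (k + 1)) (n - k))
    {q : Phase S.ι} (hq : q ∈ S.dom) : VectorField.lieBracket ℝ (S.Z a) (S.Z d) q = 0 := by
  rw [hS.bracket a d q hq]
  refine Finset.sum_eq_zero fun e _ => ?_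
  by_cases he : structConst b a d e = 0
  · rw [he, zero_smul]
  · have h1 := hb.mem_succ_of_structConst_ne_zero (mem_coset.1 ha).1 (mem_coset.1 hd).1 he
    rw [show n - (k + 1) + 1 = n - k by omega] at h1
    rw [Stage.generator_eq_zero_of_mem hL hzero h1 hq, smul_zero]

/-- `g^(n-k-1)` is an ideal, and its generators outside the coset lie in `g^(n-k)` and are zero.
This is the condition of `exists_isReduction`. -/
lemma Stage.lieBracket_eq_sum_next_coset (hL : IsLevelSolvable L n) (hb : IsAdapted b)
    (hS : S.IsSymmetric (structConst b))
    (hzero : ∀ a ∈ coset b (n - k) n, ∀ q ∈ S.dom, S.Z a q = 0) {d : Fin r}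
    (hd : d ∈ coset b (n - (k + 1)) (n - k)) (a : Fin r) {q : Phase S.ι} (hq : q ∈ S.dom) :
    VectorField.lieBracket ℝ (S.Z d) (S.Z a) q
      = ∑ e ∈ coset b (n - (k + 1)) (n - k), structConst b d a e • S.Z e q := by
  rw [hS.bracket d a q hq]
  refine (Finset.sum_subset (Finset.subset_univ _) fun e _ he => ?_).symm
  by_cases h0 : structConst b d a e = 0
  · rw [h0, zero_smul]
  · have h1 := hb.mem_of_structConst_ne_zero (mem_coset.1 hd).1 h0
    rw [mem_coset, not_and, not_not] at he
    rw [Stage.generator_eq_zero_of_mem hL hzero (he h1) hq, smul_zero]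

end Stages

theorem theorem4 {N r n : ℕ} {L : Type*} [LieRing L] [LieAlgebra ℝ L]
    (b : Module.Basis (Fin r) ℝ L) (hL : IsLevelSolvable L n) (hb : IsAdapted b)
    (E : ODESystem N) (X : Fin r → Phase (Fin N) → Phase (Fin N))
    (hX : IsSymmetryAlgebra E b X) (p₀ : Phase E.Jet) (hp₀ : p₀ ∈ E.dom) :
    -- whatever the first `k` steps were:
    (∀ (k : ℕ) (S : Stage r) (p : Phase S.ι),
      FirstIntegration b n (E.toStage X) p₀ k S p →
      -- the reduced generators are symmetries of the reduced system,
      S.IsSymmetric (structConst b) ∧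
      -- those of the cosets already used have disappeared, and the number of variables has
      -- decreased by their number,
      (∀ a ∈ coset b (n - k) n, ∀ q ∈ S.dom, S.Z a q = 0) ∧
      Fintype.card S.ι + (coset b (n - k) n).card = Fintype.card E.Jet ∧
      -- the others form an algebra, with the original structure constants,
      (∀ a ∈ coset b 0 (n - k), ∀ d ∈ coset b 0 (n - k), ∀ q ∈ S.dom,
        VectorField.lieBracket ℝ (S.Z a) (S.Z d) q
          = ∑ e ∈ coset b 0 (n - k), structConst b a d e • S.Z e q) ∧
      (k < n →
        -- the generators of the next coset form an Abelian algebra,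
        (∀ a ∈ coset b (n - (k + 1)) (n - k), ∀ d ∈ coset b (n - (k + 1)) (n - k),
          ∀ q ∈ S.dom, VectorField.lieBracket ℝ (S.Z a) (S.Z d) q = 0) ∧
        -- if they act transitively in a suitable subspace, they can be brought to normal form
        -- by new coordinates of that subspace,
        (∀ J : Set (Option S.ι),
          S.ActsTransitively (coset b (n - (k + 1)) (n - k)) J p →
          ∃ (m : ℕ) (c : NormalChart S (coset b (n - (k + 1)) (n - k)) (Fin m)),
            p ∈ c.Φ.source ∧ c.IsOver J) ∧
        -- and in any coordinates with the normal form the system and all the generators reduce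
        (∀ (κ : Type) [Fintype κ] (c : NormalChart S (coset b (n - (k + 1)) (n - k)) κ),
          ∃ domT AT ZT, c.IsReduction (κ := κ) domT AT ZT))) ∧
    -- if each coset acts transitively in a suitable subspace, the method can be applied `n` times,
    -- and then all the generators have been used
    ((∀ k < n, ∀ (S : Stage r) (p : Phase S.ι),
        FirstIntegration b n (E.toStage X) p₀ k S p →
        ∃ J : Set (Option S.ι), S.ActsTransitively (coset b (n - (k + 1)) (n - k)) J p) →
      ∃ (S : Stage r) (p : Phase S.ι), FirstIntegration b n (E.toStage X) p₀ n S p ∧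
        (∀ a, ∀ q ∈ S.dom, S.Z a q = 0) ∧
        Fintype.card S.ι + r = Fintype.card E.Jet) := by
  have hS₀ : (E.toStage X).IsSymmetric (structConst b) :=
    ODESystem.toStage_isSymmetric hX.symm hX.bracket
  refine ⟨fun k S p h => ?_, fun htrans => ?_⟩
  · obtain ⟨-, hp, hS, hzero, hcard⟩ := h.invariants hL hS₀
    refine ⟨hS, hzero, hcard,
      fun a _ d _ q hq => Stage.lieBracket_eq_sum_coset hL hS hzero a d hq, fun hk => ?_⟩
    have habel : ∀ a ∈ coset b (n - (k + 1)) (n - k), ∀ d ∈ coset b (n - (k + 1)) (n - k),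
        ∀ q ∈ S.dom, VectorField.lieBracket ℝ (S.Z a) (S.Z d) q = 0 :=
      fun a ha d hd q hq => Stage.lieBracket_eq_zero hL hb hk hS hzero ha hd hq
    exact ⟨habel, fun J hJ => NormalChart.exists_isOver hS hp habel hJ,
      fun κ _ c => c.exists_isReduction hS fun d hd a q hq =>
        ⟨_, Stage.lieBracket_eq_sum_next_coset hL hb hS hzero hd a hq⟩⟩
  -- The invariants hold for every choice of steps, so one chart and one reduction per stage suffice
  -- to continue.
  · have hreach : ∀ k ≤ n, ∃ (S : Stage r) (p : Phase S.ι),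
        FirstIntegration b n (E.toStage X) p₀ k S p := by
      intro k
      induction k with
      | zero => exact fun _ => ⟨_, _, .start hp₀⟩
      | succ k ih =>
        intro hk
        obtain ⟨S, p, h⟩ := ih (by omega)
        obtain ⟨-, hp, hS, hzero, -⟩ := h.invariants hL hS₀
        obtain ⟨J, hJ⟩ := htrans k hk S p h
        obtain ⟨m, c, hpc, -⟩ := NormalChart.exists_isOver hS hp
          (fun a ha d hd q hq => Stage.lieBracket_eq_zero hL hb hk hS hzero ha hd hq) hJ
        obtain ⟨domT, AT, ZT, hT⟩ := c.exists_isReduction hS fun d hd a q hq =>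
          ⟨_, Stage.lieBracket_eq_sum_next_coset hL hb hS hzero hd a hq⟩
        exact ⟨_, _, h.step hk c hpc hT⟩
    obtain ⟨S, p, h⟩ := hreach n le_rfl
    obtain ⟨-, -, -, hzero, hcard⟩ := h.invariants hL hS₀
    rw [Nat.sub_self, hL.coset_zero] at hzero hcard
    refine ⟨S, p, h, fun a => hzero a (Finset.mem_univ a), ?_⟩
    rw [Finset.card_univ, Fintype.card_fin] at hcard
    exact hcard
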